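/- A *polynomial monad* is a monad $P$ on $\mathbf{Set}/I$ represented by a diagram of sets $I \xleftarrow{s} E \xrightarrow{p} B \xrightarrow{t} I$ with finite fibres of $p$ (elements of $I$, $B$, $E$ are called types, operations, and operations with a marked input), with cartesian unit and multiplication. A morphism of polynomial monads is a morphism of such diagrams whose middle square (the one formed with $p$) is cartesian and which respects the monad structures; this gives the category $\mathbf{PM}$. The *Baez–Dolan construction* sends a polynomial monad $P$ to the polynomial monad $BD(P)$ represented by $$B \longleftarrow \mathrm{tr}^\bullet(P) \longrightarrow \mathrm{tr}(P) \longrightarrow B ,$$ where $\mathrm{tr}(P)$ is the set of $P$-trees (finite rooted trees with edges decorated by types and nodes decorated by operations, compatibly), $\mathrm{tr}^\bullet(P)$ is the set of $P$-trees with a marked node, the maps are: the operation at the marked node, forgetting the mark, and the composite in $P$ of all the nodes of the tree; the unit is given by the one-node trees and the multiplication by substitution of trees into nodes. It is a functor $BD : \mathbf{PM} \to \mathbf{PM}$, where morphisms act on trees by changing decorations. Let $\mathrm{Id}$ be the trivial monad, represented by $1 \leftarrow 1 \to 1 \to 1$, and let $S_0 : \mathrm{Id} \to BD(\mathrm{Id})$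 be the unique morphism. Put $P^n = BD^n(\mathrm{Id})$ and $S_n = BD^n(S_0) : P^n \to P^{n+1}$. The set $Z^n$ of types of $P^n$ is the set of *$n$-opetopes*, and $P^n$ is represented by $Z^n \leftarrow \overline{Z}{}^{n+1} \to Z^{n+1} \to Z^n$, where $\overline{Z}{}^{n+1}$ is the set of $(n+1)$-opetopes with a marked input facet; $S_n$ is the *suspension*. The colimit $Z^\infty$ of the sets $Z^n$ along suspension is the set of *stable opetopes*, and the *polynomial monad of stable opetopes* $P^\infty$ is represented by the diagram $$Z^\infty \longleftarrow \overline{Z}{}^{\infty} \longrightarrow Z^{\infty} \longrightarrow Z^\infty$$ of colimits, along suspension, of the diagrams representing the $P^n$, with the monad structure induced by those of the $P^n$. Let $\mathbf{PM}_*$ be the category of *pointed* polynomial monads, i.e. polynomial monads $M$ equipped with a morphism $i : \mathrm{Id} \to M$, with the morphisms that respect the map from $\mathrm{Id}$. Let $BD : \mathbf{PM}_* \to \mathbf{PM}_*$ be the functor that sends $i : \mathrm{Id} \to M$ to $\mathrm{Id} \xrightarrow{S_0} BD(\mathrm{Id}) \xrightarrow{BD(i)} BD(M)$. Regard each $P^n$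 as the $n$-th iterate of this functor on $(\mathrm{Id}, \mathrm{id})$, and $P^\infty$ as pointed by the canonical morphism $\mathrm{Id} = P^0 \to P^\infty$. **Proposition.** $P^\infty$ is a least fixpoint of $BD : \mathbf{PM}_* \to \mathbf{PM}_*$, and it is the colimit of $\mathrm{Id} \to BD(\mathrm{Id}) \to BD^2(\mathrm{Id}) \to \cdots$. Precisely: the morphisms $S_n$ and the canonical morphisms $\iota_n : P^n \to P^\infty$ are morphisms in $\mathbf{PM}_*$; the cocone $(\iota_n)_{n \ge 0}$ is a colimit in $\mathbf{PM}_*$ of the chain of the $S_n$; and there is an isomorphism $\varphi : BD(P^\infty) \to P^\infty$ in $\mathbf{PM}_*$ with $\varphi \circ BD(\iota_n) = \iota_{n+1}$ for all $n \ge 0$, such that $(P^\infty, \varphi)$ is an initial algebra for the endofunctor $BD$ of $\mathbf{PM}_*$. -/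

import Mathlib

universe u

set_option linter.unusedVariables false

/-- A polynomial endofunctor `I ← E → B → I` with finite fibres of `p : E → B`: types `I`, operations
`B`, partial operations (operations with a marked input) `E`; `t` is the output type of an operation
and `s` the type of the marked input. -/
structure PolyEndo where
  I : Type u
  B : Type u
  E : Type u
  s : E → I
  p : E → B
  t : B → I
  finite_fib : ∀ b : B, Finite {e : E // p e = b}

namespace PolyEndo

/-- The set of inputs of an operation `b`, i.e. the fibre of `p` over `b`. -/
abbrev Fib (P : PolyEndo.{u}) (b : P.B) : Type u := {e : P.E // P.p e = b}

/-- An operation of the composite `P ∘ P`: an operation `op` of `P` together with, for each of its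
inputs `e`, an operation `top e` of `P` whose output type is the type of `e`. -/
structure TwoLevel (P : PolyEndo.{u}) where
  op : P.B
  top : P.Fib op → P.B
  compat : ∀ e : P.Fib op, P.t (top e) = P.s e.1

theorem TwoLevel.ext_fib {P : PolyEndo.{u}} {x y : P.TwoLevel} (h : x.op = y.op)
    (h' : ∀ e (he : P.p e = x.op) (he' : P.p e = y.op), x.top ⟨e, he⟩ = y.top ⟨e, he'⟩) :
    x = y := by
  obtain ⟨b, c, hc⟩ := x
  obtain ⟨b', c', hc'⟩ := y
  obtain rfl : b = b' := h
  obtain rfl : c = c' := funext fun e => h' e.1 e.2 e.2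
  rfl

end PolyEndo

/-- A polynomial monad: a polynomial endofunctor `P` with cartesian natural transformations
`η : Id → P` and `μ : P ∘ P → P` subject to the unit and associativity laws, written out on the
representing sets. `unit` and `mul` are the effect of `η` and `μ` on operations, `unitE` and `mulE`
their effect on inputs; that `η` and `μ` are cartesian says that `unit i` has exactly one input
`unitE i`, and that the inputs of `mul x` are, via `mulE`, the pairs of an input `e` of `x.op` and an
input of `x.top e`. The laws are stated on operations and on inputs. -/
structure PolyMonad extends PolyEndo.{u} where
  unit : I → B
  t_unit : ∀ i, t (unit i) = i
  unitE : ∀ i, toPolyEndo.Fib (unit i)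
  unitE_unique : ∀ i (e : toPolyEndo.Fib (unit i)), e = unitE i
  s_unitE : ∀ i, s (unitE i).1 = i
  mul : toPolyEndo.TwoLevel → B
  t_mul : ∀ x, t (mul x) = t x.op
  mulE : ∀ x : toPolyEndo.TwoLevel,
    (Σ e : toPolyEndo.Fib x.op, toPolyEndo.Fib (x.top e)) ≃ toPolyEndo.Fib (mul x)
  s_mulE : ∀ x e f, s (mulE x ⟨e, f⟩).1 = s f.1
  unit_mul : ∀ i c hc, mul ⟨unit i, c, hc⟩ = c (unitE i)
  unit_mulE : ∀ i c hc f, (mulE ⟨unit i, c, hc⟩ ⟨unitE i, f⟩).1 = f.1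
  mul_unit : ∀ b, mul ⟨b, fun e => unit (s e.1), fun _ => t_unit _⟩ = b
  mulE_unit : ∀ b e,
    (mulE ⟨b, fun e => unit (s e.1), fun _ => t_unit _⟩ ⟨e, unitE (s e.1)⟩).1 = e.1
  assoc : ∀ (x : toPolyEndo.TwoLevel) (d : toPolyEndo.Fib (mul x) → B)
    (hd : ∀ g, t (d g) = s g.1),
    mul ⟨mul x, d, hd⟩ =
      mul ⟨x.op,
        fun e => mul ⟨x.top e, fun f => d (mulE x ⟨e, f⟩),
          fun _ => (hd _).trans (s_mulE x _ _)⟩,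
        fun e => (t_mul _).trans (x.compat e)⟩
  assocE : ∀ (x : toPolyEndo.TwoLevel) (d : toPolyEndo.Fib (mul x) → B)
    (hd : ∀ g, t (d g) = s g.1) (e : toPolyEndo.Fib x.op) (f : toPolyEndo.Fib (x.top e))
    (g : toPolyEndo.Fib (d (mulE x ⟨e, f⟩))),
    (mulE ⟨mul x, d, hd⟩ ⟨mulE x ⟨e, f⟩, g⟩).1 =
      (mulE ⟨x.op,
        fun e => mul ⟨x.top e, fun f => d (mulE x ⟨e, f⟩),
          fun _ => (hd _).trans (s_mulE x _ _)⟩,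
        fun e => (t_mul _).trans (x.compat e)⟩
        ⟨e, mulE ⟨x.top e, fun f => d (mulE x ⟨e, f⟩),
          fun _ => (hd _).trans (s_mulE x _ _)⟩ ⟨f, g⟩⟩).1

/-- Trees with edges labelled by types and nodes by operations, before imposing the typing condition. -/
inductive PreTree (P : PolyEndo.{u}) : Type u
  | edge (i : P.I) : PreTree P
  | node (b : P.B) (ch : P.Fib b → PreTree P) : PreTree P

namespace PreTree

variable {P : PolyEndo.{u}}

/-- The type of the root edge. -/
def root : PreTree P → P.I
  | edge i => i
  | node b _ => P.t b

/-- The typing condition: the subtree planted in an input `e` has a root edge of type `s e`. -/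
def WF : PreTree P → Prop
  | edge _ => True
  | node _ ch => ∀ e, (ch e).root = P.s e.1 ∧ (ch e).WF

/-- `T.NodeAt l b`: following the inputs in the list `l`, starting from the root, leads to a node of `T`,
and this node is decorated by `b`. The nodes of `T` are thus identified with their addresses `l`. -/
def NodeAt : PreTree P → List P.E → P.B → Prop
  | edge _, _, _ => False
  | node b _, [], b' => b = b'
  | node b ch, e :: l, b' => ∃ h : P.p e = b, NodeAt (ch ⟨e, h⟩) l b'

theorem NodeAt.unique : ∀ {T : PreTree P} {l : List P.E} {b b' : P.B},
    T.NodeAt l b → T.NodeAt l b' → b = b'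
  | edge _, _, _, _, h, _ => h.elim
  | node _ _, [], _, _, h, h' => h.symm.trans h'
  | node _ _, _ :: _, _, _, ⟨_, h⟩, ⟨_, h'⟩ => NodeAt.unique h h'

theorem finite_nodes : ∀ T : PreTree P, {l : List P.E | ∃ b, T.NodeAt l b}.Finite
  | edge _ => by simp [NodeAt]
  | node b ch => by
    have := P.finite_fib b
    have h : {l : List P.E | ∃ b', (node b ch).NodeAt l b'} ⊆
        {[]} ∪ ⋃ e : P.Fib b, (fun l => e.1 :: l) '' {l | ∃ b', (ch e).NodeAt l b'} := by
      rintro (_ | ⟨e, l⟩) ⟨b', hl⟩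
      · simp
      · obtain ⟨he, hl⟩ := hl
        right
        exact Set.mem_iUnion.2 ⟨⟨e, he⟩, l, ⟨b', hl⟩, rfl⟩
    exact ((Set.finite_singleton _).union
      (Set.finite_iUnion fun e => (finite_nodes (ch e)).image _)).subset h

end PreTree

namespace PolyMonad

open PreTree

variable (M : PolyMonad.{u})

theorem mulE_congr {x y : M.TwoLevel} {e : M.Fib x.op} {f : M.Fib (x.top e)}
    {e' : M.Fib y.op} {f' : M.Fib (y.top e')} (hxy : x = y) (he : e.1 = e'.1)
    (hf : f.1 = f'.1) : (M.mulE x ⟨e, f⟩).1 = (M.mulE y ⟨e', f'⟩).1 := by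
  subst hxy
  obtain rfl : e = e' := Subtype.ext he
  obtain rfl : f = f' := Subtype.ext hf
  rfl

/-- The total contraction of a tree, obtained by multiplying together all its nodes in the monad.
The leaves of the tree are in bijection with the inputs of its total contraction. -/
def tot : (T : PreTree M.toPolyEndo) → T.WF → {b : M.B // M.t b = T.root}
  | edge i, _ => ⟨M.unit i, M.t_unit i⟩
  | node b ch, w =>
    ⟨M.mul ⟨b, fun e => (tot (ch e) (w e).2).1, fun e => (tot (ch e) (w e).2).2.trans (w e).1⟩,
      M.t_mul _⟩

/-- The two-level tree that arises by contracting the trees planted in the inputs of `b`. -/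
def level (b : M.B) (ch : M.Fib b → PreTree M.toPolyEndo) (w : (node b ch).WF) : M.TwoLevel :=
  ⟨b, fun e => (M.tot (ch e) (w e).2).1, fun e => (M.tot (ch e) (w e).2).2.trans (w e).1⟩

/-- `graft T w f`: plant the tree `f x` in the leaf `x` of `T`, for every leaf `x`. -/
def graft : (T : PreTree M.toPolyEndo) → (w : T.WF) →
    (M.Fib (M.tot T w).1 → PreTree M.toPolyEndo) → PreTree M.toPolyEndo
  | edge i, _, f => f (M.unitE i)
  | node b ch, w, f =>
    node b fun e => graft (ch e) (w e).2 fun y => f (M.mulE (M.level b ch w) ⟨e, y⟩)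

/-- The address of the leaf `x` of a tree `T`. -/
noncomputable def leafPath : (T : PreTree M.toPolyEndo) → (w : T.WF) →
    M.Fib (M.tot T w).1 → List M.E
  | edge _, _, _ => []
  | node b ch, w, x =>
    let ef := (M.mulE (M.level b ch w)).symm x
    ef.1.1 :: leafPath (ch ef.1) (w ef.1).2 ef.2

theorem leafPath_node {b : M.B} {ch : M.Fib b → PreTree M.toPolyEndo} (w : (node b ch).WF)
    (e : M.Fib b) (y : M.Fib (M.tot (ch e) (w e).2).1) :
    M.leafPath (node b ch) w (M.mulE (M.level b ch w) ⟨e, y⟩) =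
      e.1 :: M.leafPath (ch e) (w e).2 y := by
  have key : ∀ q : (Σ e : M.Fib b, M.Fib (M.tot (ch e) (w e).2).1), q = ⟨e, y⟩ →
      q.1.1 :: M.leafPath (ch q.1) (w q.1).2 q.2 = e.1 :: M.leafPath (ch e) (w e).2 y := by
    rintro _ rfl
    rfl
  exact key _ ((M.mulE (M.level b ch w)).symm_apply_apply ⟨e, y⟩)

theorem exists_mulE {b : M.B} {ch : M.Fib b → PreTree M.toPolyEndo} (w : (node b ch).WF)
    (x : M.Fib (M.tot (node b ch) w).1) :
    ∃ (e : M.Fib b) (y : M.Fib (M.tot (ch e) (w e).2).1),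
      x = M.mulE (M.level b ch w) ⟨e, y⟩ := by
  obtain ⟨⟨e, y⟩, h⟩ := (M.mulE (M.level b ch w)).surjective x
  exact ⟨e, y, h.symm⟩

theorem compat_child {b : M.B} {ch : M.Fib b → PreTree M.toPolyEndo} (w : (node b ch).WF)
    {f : M.Fib (M.tot (node b ch) w).1 → PreTree M.toPolyEndo}
    (hf : ∀ x, (f x).root = M.s x.1 ∧ (f x).WF) (e : M.Fib b)
    (y : M.Fib (M.tot (ch e) (w e).2).1) :
    (f (M.mulE (M.level b ch w) ⟨e, y⟩)).root = M.s y.1 ∧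
      (f (M.mulE (M.level b ch w) ⟨e, y⟩)).WF :=
  ⟨(hf _).1.trans (M.s_mulE _ _ _), (hf _).2⟩

theorem root_graft : ∀ (T : PreTree M.toPolyEndo) (w : T.WF)
    (f : M.Fib (M.tot T w).1 → PreTree M.toPolyEndo)
    (_ : ∀ x, (f x).root = M.s x.1), (M.graft T w f).root = T.root
  | edge i, _, f, hf => (hf _).trans (M.s_unitE i)
  | node b ch, w, f, hf => rfl

theorem wf_graft : ∀ (T : PreTree M.toPolyEndo) (w : T.WF)
    (f : M.Fib (M.tot T w).1 → PreTree M.toPolyEndo)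
    (_ : ∀ x, (f x).root = M.s x.1 ∧ (f x).WF), (M.graft T w f).WF
  | edge i, _, f, hf => (hf _).2
  | node b ch, w, f, hf => fun e =>
    ⟨(root_graft _ _ _ _ fun y => (hf _).1.trans (M.s_mulE _ _ _)).trans (w e).1,
      wf_graft _ _ _ fun y => ⟨(hf _).1.trans (M.s_mulE _ _ _), (hf _).2⟩⟩

theorem tot_congr {T T' : PreTree M.toPolyEndo} (h : T = T') (w : T.WF) (w' : T'.WF) :
    (M.tot T w).1 = (M.tot T' w').1 := by subst h; rfl

theorem tot_graft : ∀ (T : PreTree M.toPolyEndo) (w : T.WF)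
    (f : M.Fib (M.tot T w).1 → PreTree M.toPolyEndo)
    (hf : ∀ x, (f x).root = M.s x.1 ∧ (f x).WF),
    (M.tot (M.graft T w f) (M.wf_graft T w f hf)).1 =
      M.mul ⟨(M.tot T w).1, fun x => (M.tot (f x) (hf x).2).1,
        fun x => (M.tot (f x) (hf x).2).2.trans (hf x).1⟩
  | edge i, _, f, hf => (M.unit_mul i (fun x => (M.tot (f x) (hf x).2).1) _).symm
  | node b ch, w, f, hf => by
    refine Eq.trans ?_ (M.assoc (M.level b ch w) _ _).symm
    simp only [graft, tot]
    congr 2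
    funext e
    exact tot_graft (ch e) (w e).2 _ (M.compat_child w hf e)

theorem graft_congr {T T' : PreTree M.toPolyEndo} (h : T = T') (w : T.WF) (w' : T'.WF)
    {f : M.Fib (M.tot T w).1 → PreTree M.toPolyEndo}
    {f' : M.Fib (M.tot T' w').1 → PreTree M.toPolyEndo}
    (hf : ∀ x x', x.1 = x'.1 → f x = f' x') : M.graft T w f = M.graft T' w' f' := by
  subst h
  congr 1
  funext x
  exact hf x x rfl

theorem leafPath_congr {T T' : PreTree M.toPolyEndo} (h : T = T') (w : T.WF) (w' : T'.WF)
    {x : M.Fib (M.tot T w).1} {x' : M.Fib (M.tot T' w').1}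
    (hf : x.1 = x'.1) : M.leafPath T w x = M.leafPath T' w' x' := by
  subst h
  obtain rfl := Subtype.ext hf
  rfl

theorem graft_edge : ∀ (T : PreTree M.toPolyEndo) (w : T.WF),
    M.graft T w (fun x => edge (M.s x.1)) = T
  | edge i, _ => by simp [graft, M.s_unitE]
  | node b ch, w => by
    change node b _ = node b _
    congr 1
    funext e
    refine Eq.trans ?_ (graft_edge (ch e) (w e).2)
    congr 1
    funext y
    exact congrArg edge (M.s_mulE _ _ _)

/-- The leaf of `graft T w f` that comes from the leaf `y` of the tree planted in the leaf `x` of `T`. -/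
def graftIn (T : PreTree M.toPolyEndo) (w : T.WF)
    (f : M.Fib (M.tot T w).1 → PreTree M.toPolyEndo)
    (hf : ∀ x, (f x).root = M.s x.1 ∧ (f x).WF) (x : M.Fib (M.tot T w).1)
    (y : M.Fib (M.tot (f x) (hf x).2).1) :
    M.Fib (M.tot (M.graft T w f) (M.wf_graft T w f hf)).1 :=
  ⟨(M.mulE ⟨(M.tot T w).1, fun x => (M.tot (f x) (hf x).2).1,
        fun x => (M.tot (f x) (hf x).2).2.trans (hf x).1⟩ ⟨x, y⟩).1,
    (M.mulE _ ⟨x, y⟩).2.trans (M.tot_graft T w f hf).symm⟩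

theorem mulE_graft {b : M.B} {ch : M.Fib b → PreTree M.toPolyEndo} (w : (node b ch).WF)
    (f : M.Fib (M.tot (node b ch) w).1 → PreTree M.toPolyEndo)
    (hf : ∀ x, (f x).root = M.s x.1 ∧ (f x).WF) (w' : (M.graft (node b ch) w f).WF)
    (e : M.Fib b)
    (y : M.Fib (M.tot (ch e) (w e).2).1)
    (hf' : ∀ y, (f (M.mulE (M.level b ch w) ⟨e, y⟩)).root = M.s y.1 ∧
      (f (M.mulE (M.level b ch w) ⟨e, y⟩)).WF)
    (z : M.Fib (M.tot (f (M.mulE (M.level b ch w) ⟨e, y⟩)) (hf _).2).1) :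
    (M.mulE (M.level b (fun e => M.graft (ch e) (w e).2
        fun y => f (M.mulE (M.level b ch w) ⟨e, y⟩)) w') ⟨e, M.graftIn (ch e) (w e).2 _ hf' y z⟩).1
      = (M.graftIn (node b ch) w f hf (M.mulE (M.level b ch w) ⟨e, y⟩) z).1 := by
  refine Eq.trans ?_ (M.assocE (M.level b ch w) (fun x => (M.tot (f x) (hf x).2).1)
    (fun x => (M.tot (f x) (hf x).2).2.trans (hf x).1) e y z).symm
  refine M.mulE_congr ?_ rfl rfl
  refine PolyEndo.TwoLevel.ext_fib rfl fun e he he' => ?_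
  exact M.tot_graft _ _ _ (M.compat_child w hf ⟨e, he⟩)

theorem graft_graft : ∀ (T : PreTree M.toPolyEndo) (w : T.WF)
    (f : M.Fib (M.tot T w).1 → PreTree M.toPolyEndo)
    (hf : ∀ x, (f x).root = M.s x.1 ∧ (f x).WF)
    (w' : (M.graft T w f).WF)
    (g : M.Fib (M.tot (M.graft T w f) w').1 → PreTree M.toPolyEndo),
    M.graft (M.graft T w f) w' g =
      M.graft T w fun x => M.graft (f x) (hf x).2 fun y => g (M.graftIn T w f hf x y)
  | edge i, _, f, hf, w', g => by
    simp only [graft]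
    refine M.graft_congr rfl _ _ fun x x' h => ?_
    congr 1
    refine Subtype.ext (h.trans ?_)
    exact (M.unit_mulE i (fun x => (M.tot (f x) (hf x).2).1) _ x').symm
  | node b ch, w, f, hf, w', g => by
    change node b _ = node b _
    congr 1
    funext e
    have hf' := M.compat_child w hf e
    refine (graft_graft (ch e) (w e).2 _ hf' _ _).trans ?_
    refine M.graft_congr rfl _ _ fun x x' h => ?_
    obtain rfl := Subtype.ext h
    refine M.graft_congr rfl _ _ fun y y' h => ?_
    obtain rfl := Subtype.ext h
    congr 1
    refine Subtype.ext ?_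
    exact M.mulE_graft w f hf w' e x hf' y

theorem leafPath_graft : ∀ (T : PreTree M.toPolyEndo) (w : T.WF)
    (f : M.Fib (M.tot T w).1 → PreTree M.toPolyEndo)
    (hf : ∀ x, (f x).root = M.s x.1 ∧ (f x).WF)
    (w' : (M.graft T w f).WF) (x : M.Fib (M.tot T w).1)
    (y : M.Fib (M.tot (f x) (hf x).2).1),
    M.leafPath (M.graft T w f) w' (M.graftIn T w f hf x y) =
      M.leafPath T w x ++ M.leafPath (f x) (hf x).2 y
  | edge i, _, f, hf, w', x, y => by
    obtain rfl := M.unitE_unique i x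
    refine M.leafPath_congr rfl _ _ ?_
    exact M.unit_mulE i (fun x => (M.tot (f x) (hf x).2).1) _ y
  | node b ch, w, f, hf, w', x, z => by
    obtain ⟨e, y, rfl⟩ := M.exists_mulE w x
    have hf' := M.compat_child w hf e
    rw [M.leafPath_node, List.cons_append, ← leafPath_graft (ch e) (w e).2 _ hf' (w' e).2 y z,
      ← M.leafPath_node w']
    exact M.leafPath_congr rfl _ _ (M.mulE_graft w f hf w' e y hf' z).symm

theorem nodeAt_graft_in : ∀ (T : PreTree M.toPolyEndo) (w : T.WF)
    (f : M.Fib (M.tot T w).1 → PreTree M.toPolyEndo) {l : List M.E} {b : M.B},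
    T.NodeAt l b → (M.graft T w f).NodeAt l b
  | edge _, _, _, _, _, h => h.elim
  | node _ _, _, _, [], _, h => h
  | node _ ch, w, _, _ :: _, _, ⟨h, h'⟩ => ⟨h, nodeAt_graft_in (ch ⟨_, h⟩) (w _).2 _ h'⟩

theorem nodeAt_graft_out : ∀ (T : PreTree M.toPolyEndo) (w : T.WF)
    (f : M.Fib (M.tot T w).1 → PreTree M.toPolyEndo) (x) {l : List M.E} {b : M.B},
    (f x).NodeAt l b → (M.graft T w f).NodeAt (M.leafPath T w x ++ l) b
  | edge i, _, f, x, l, b, h => by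
    obtain rfl := M.unitE_unique i x
    exact h
  | node b ch, w, f, x, l, b', h => by
    obtain ⟨e, y, rfl⟩ := M.exists_mulE w x
    rw [M.leafPath_node]
    exact ⟨e.2, nodeAt_graft_out (ch e) (w e).2 _ y h⟩

theorem nodeAt_graft : ∀ (T : PreTree M.toPolyEndo) (w : T.WF)
    (f : M.Fib (M.tot T w).1 → PreTree M.toPolyEndo) {q : List M.E} {b : M.B},
    (M.graft T w f).NodeAt q b → T.NodeAt q b ∨
      ∃ x l, q = M.leafPath T w x ++ l ∧ (f x).NodeAt l b
  | edge i, _, f, q, b, h => Or.inr ⟨M.unitE i, q, rfl, h⟩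
  | node _ _, _, _, [], _, h => Or.inl h
  | node b ch, w, f, e :: q, b', ⟨h, h'⟩ => by
    obtain h' | ⟨y, l, rfl, h2⟩ := nodeAt_graft (ch ⟨e, h⟩) (w _).2 _ h'
    · exact Or.inl ⟨h, h'⟩
    · exact Or.inr ⟨M.mulE (M.level b ch w) ⟨⟨e, h⟩, y⟩, l,
        congrArg (· ++ l) (M.leafPath_node w ⟨e, h⟩ y).symm, h2⟩

theorem not_nodeAt_leafPath : ∀ (T : PreTree M.toPolyEndo) (w : T.WF) (x)
    (l : List M.E) (b : M.B), ¬ T.NodeAt (M.leafPath T w x ++ l) b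
  | edge _, _, _, _, _ => id
  | node b ch, w, x, l, b' => by
    obtain ⟨e, y, rfl⟩ := M.exists_mulE w x
    rw [M.leafPath_node]
    rintro ⟨_, h⟩
    exact not_nodeAt_leafPath (ch e) (w e).2 y l b' h

theorem leafPath_inj : ∀ (T : PreTree M.toPolyEndo) (w : T.WF) (x x')
    (l l' : List M.E), M.leafPath T w x ++ l = M.leafPath T w x' ++ l' → x = x' ∧ l = l'
  | edge i, _, x, x', l, l', h =>
    ⟨(M.unitE_unique i x).trans (M.unitE_unique i x').symm, h⟩
  | node b ch, w, x, x', l, l', h => by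
    obtain ⟨e, y, rfl⟩ := M.exists_mulE w x
    obtain ⟨e', y', rfl⟩ := M.exists_mulE w x'
    simp only [M.leafPath_node, List.cons_append, List.cons.injEq] at h
    obtain ⟨h1, h2⟩ := h
    obtain rfl := Subtype.ext h1
    obtain ⟨rfl, rfl⟩ := leafPath_inj _ _ _ _ _ _ h2
    exact ⟨rfl, rfl⟩

/-- The set `tr(P)` of `P`-trees, where `P` is the underlying polynomial endofunctor of `M`. -/
abbrev Tree : Type u := {T : PreTree M.toPolyEndo // T.WF}

/-- The operation of `M` obtained by contracting all inner edges of a `P`-tree. -/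
def total (T : M.Tree) : M.B := (M.tot T.1 T.2).1

/-- `c` assigns to each node of `T` a tree whose total contraction is the operation decorating that
node. (The values of `c` outside the nodes of `T` are irrelevant.) -/
def Matches (T : PreTree M.toPolyEndo) (c : List M.E → M.Tree) : Prop :=
  ∀ l b, T.NodeAt l b → M.total (c l) = b

variable {M}

theorem Matches.root {b : M.B} {ch : M.Fib b → PreTree M.toPolyEndo} {c : List M.E → M.Tree}
    (hc : M.Matches (node b ch) c) : M.total (c []) = b := hc [] b rfl

theorem Matches.child {b : M.B} {ch : M.Fib b → PreTree M.toPolyEndo} {c : List M.E → M.Tree}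
    (hc : M.Matches (node b ch) c) (e : M.Fib b) :
    M.Matches (ch e) (fun l => c (e.1 :: l)) := fun l b' h => hc (e.1 :: l) b' ⟨e.2, h⟩

variable (M)

/-- Substitute into each node of `T`, at address `l` say, the tree `c l`. -/
def subst : (T : PreTree M.toPolyEndo) → (c : List M.E → M.Tree) → M.Matches T c →
    PreTree M.toPolyEndo
  | edge i, _, _ => edge i
  | node b ch, c, hc =>
    M.graft (c []).1 (c []).2 fun x =>
      subst (ch ⟨x.1, x.2.trans hc.root⟩) (fun l => c (x.1 :: l)) (hc.child ⟨x.1, _⟩)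

open Classical in
/-- The address, inside `subst T c hc`, of the root edge of the tree substituted into the node of `T`
with address `l`. -/
noncomputable def expand : (T : PreTree M.toPolyEndo) → (c : List M.E → M.Tree) →
    M.Matches T c → List M.E → List M.E
  | edge _, _, _, _ => []
  | node _ _, _, _, [] => []
  | node b ch, c, hc, e :: l =>
    if h : M.p e = b then
      M.leafPath (c []).1 (c []).2 ⟨e, h.trans hc.root.symm⟩ ++
        expand (ch ⟨e, h⟩) (fun l => c (e :: l)) (hc.child ⟨e, h⟩) l
    else []

theorem expand_cons {b : M.B} {ch : M.Fib b → PreTree M.toPolyEndo} {c : List M.E → M.Tree}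
    (hc : M.Matches (node b ch) c) (e : M.Fib b) (l : List M.E) :
    M.expand (node b ch) c hc (e.1 :: l) =
      M.leafPath (c []).1 (c []).2 ⟨e.1, e.2.trans hc.root.symm⟩ ++
        M.expand (ch e) (fun l => c (e.1 :: l)) (hc.child e) l := by
  simp [expand, e.2]

theorem expand_nil (T : PreTree M.toPolyEndo) (c : List M.E → M.Tree) (hc : M.Matches T c) :
    M.expand T c hc [] = [] := by
  cases T <;> rfl

theorem Matches.congr {T T' : PreTree M.toPolyEndo} {c c' : List M.E → M.Tree} (h : T = T')
    (hcc : ∀ l b, T.NodeAt l b → c l = c' l) (hc : M.Matches T c) : M.Matches T' c' := by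
  subst h
  intro l b hl
  rw [← hcc l b hl]
  exact hc l b hl

theorem subst_congr_aux : ∀ (T : PreTree M.toPolyEndo) {c c' : List M.E → M.Tree}
    (hc : M.Matches T c) (hc' : M.Matches T c') (h : ∀ l b, T.NodeAt l b → c l = c' l),
    M.subst T c hc = M.subst T c' hc'
  | edge _, _, _, _, _, _ => rfl
  | node b ch, c, c', hc, hc', h => by
    have h0 : c [] = c' [] := h [] b rfl
    refine M.graft_congr (congrArg Subtype.val h0) _ _ fun x x' hx => ?_
    obtain ⟨x, hx1⟩ := x
    obtain ⟨x', hx2⟩ := x'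
    obtain rfl : x = x' := hx
    exact subst_congr_aux _ _ _ fun l b' hl => h (x :: l) b' ⟨hx1.trans hc.root, hl⟩

theorem subst_congr {T T' : PreTree M.toPolyEndo} (hT : T = T') {c c' : List M.E → M.Tree}
    (hc : M.Matches T c) (hc' : M.Matches T' c') (h : ∀ l b, T.NodeAt l b → c l = c' l) :
    M.subst T c hc = M.subst T' c' hc' := by
  subst hT
  exact M.subst_congr_aux T hc hc' h

theorem expand_congr_aux : ∀ (T : PreTree M.toPolyEndo) {c c' : List M.E → M.Tree}
    (hc : M.Matches T c) (hc' : M.Matches T c') (h : ∀ l b, T.NodeAt l b → c l = c' l)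
    (l : List M.E), M.expand T c hc l = M.expand T c' hc' l
  | edge _, _, _, _, _, _, _ => rfl
  | node _ _, _, _, _, _, _, [] => rfl
  | node b ch, c, c', hc, hc', h, e :: l => by
    have h0 : c [] = c' [] := h [] b rfl
    by_cases he : M.p e = b
    · rw [M.expand_cons hc ⟨e, he⟩, M.expand_cons hc' ⟨e, he⟩]
      rw [expand_congr_aux (ch ⟨e, he⟩) (hc.child ⟨e, he⟩) (hc'.child ⟨e, he⟩)
        (fun l b' hl => h (e :: l) b' ⟨he, hl⟩)]
      congr 1
      exact M.leafPath_congr (congrArg Subtype.val h0) _ _ rfl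
    · simp [expand, he]

theorem expand_congr {T T' : PreTree M.toPolyEndo} (hT : T = T') {c c' : List M.E → M.Tree}
    (hc : M.Matches T c) (hc' : M.Matches T' c') (h : ∀ l b, T.NodeAt l b → c l = c' l)
    (l : List M.E) :
    M.expand T c hc l = M.expand T' c' hc' l := by
  subst hT
  exact M.expand_congr_aux T hc hc' h l

theorem subst_spec : ∀ (T : PreTree M.toPolyEndo) (w : T.WF) (c : List M.E → M.Tree)
    (hc : M.Matches T c), (M.subst T c hc).root = T.root ∧
      ∃ w' : (M.subst T c hc).WF, (M.tot _ w').1 = (M.tot T w).1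
  | edge i, _, _, _ => ⟨rfl, trivial, rfl⟩
  | node b ch, w, c, hc => by
    have ih := fun e : M.Fib b => subst_spec (ch e) (w e).2 (fun l => c (e.1 :: l)) (hc.child e)
    have hf : ∀ x : M.Fib (M.tot (c []).1 (c []).2).1,
        (M.subst (ch ⟨x.1, x.2.trans hc.root⟩) (fun l => c (x.1 :: l))
          (hc.child ⟨x.1, _⟩)).root = M.s x.1 ∧
        (M.subst (ch ⟨x.1, x.2.trans hc.root⟩) (fun l => c (x.1 :: l))
          (hc.child ⟨x.1, _⟩)).WF :=
      fun x => ⟨(ih ⟨x.1, _⟩).1.trans (w _).1, (ih ⟨x.1, _⟩).2.1⟩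
    have hr := M.root_graft (c []).1 (c []).2 _ fun x => (hf x).1
    have ht := M.tot_graft (c []).1 (c []).2 _ hf
    have h2 : M.t (M.tot (c []).1 (c []).2).1 = (c []).1.root := (M.tot (c []).1 (c []).2).2
    have h3 : M.total (c []) = b := hc.root
    refine ⟨hr.trans (h2.symm.trans (congrArg M.t h3)), M.wf_graft _ _ _ hf, ht.trans ?_⟩
    refine congrArg M.mul (PolyEndo.TwoLevel.ext_fib h3 fun e he he' => ?_)
    exact (ih ⟨e, he'⟩).2.2

theorem subst_wf {T : PreTree M.toPolyEndo} (w : T.WF) {c : List M.E → M.Tree}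
    (hc : M.Matches T c) : (M.subst T c hc).WF := (M.subst_spec T w c hc).2.1

theorem subst_tot {T : PreTree M.toPolyEndo} (w : T.WF) {c : List M.E → M.Tree}
    (hc : M.Matches T c) (w' : (M.subst T c hc).WF) : (M.tot _ w').1 = (M.tot T w).1 :=
  (M.subst_spec T w c hc).2.2

theorem subst_compat {b : M.B} {ch : M.Fib b → PreTree M.toPolyEndo} (w : (node b ch).WF)
    {c : List M.E → M.Tree} (hc : M.Matches (node b ch) c)
    (x : M.Fib (M.tot (c []).1 (c []).2).1) :
    (M.subst (ch ⟨x.1, x.2.trans hc.root⟩) (fun l => c (x.1 :: l))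
          (hc.child ⟨x.1, _⟩)).root = M.s x.1 ∧
        (M.subst (ch ⟨x.1, x.2.trans hc.root⟩) (fun l => c (x.1 :: l))
          (hc.child ⟨x.1, _⟩)).WF :=
  ⟨(M.subst_spec _ (w _).2 _ _).1.trans (w _).1, M.subst_wf (w _).2 _⟩

theorem graftIn_subst {b : M.B} {ch : M.Fib b → PreTree M.toPolyEndo} (w : (node b ch).WF)
    {c : List M.E → M.Tree} (hc : M.Matches (node b ch) c) (e : M.Fib b)
    (y : M.Fib (M.tot (ch e) (w e).2).1)
    (y' : M.Fib (M.tot _ (M.subst_compat w hc ⟨e.1, e.2.trans hc.root.symm⟩).2).1)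
    (hy : y.1 = y'.1) :
    (M.graftIn (c []).1 (c []).2 _ (M.subst_compat w hc) ⟨e.1, e.2.trans hc.root.symm⟩ y').1 =
      (M.mulE (M.level b ch w) ⟨e, y⟩).1 := by
  refine M.mulE_congr (PolyEndo.TwoLevel.ext_fib hc.root fun e he he' => ?_) rfl hy.symm
  exact M.subst_tot (w ⟨e, he'⟩).2 _ _

theorem leafPath_subst : ∀ (T : PreTree M.toPolyEndo) (w : T.WF) (c : List M.E → M.Tree)
    (hc : M.Matches T c) (w' : (M.subst T c hc).WF) (x : M.Fib (M.tot T w).1)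
    (x' : M.Fib (M.tot (M.subst T c hc) w').1) (_ : x.1 = x'.1),
    M.leafPath _ w' x' = M.expand T c hc (M.leafPath T w x)
  | edge i, _, _, _, _, _, _, _ => rfl
  | node b ch, w, c, hc, w', x, x', hx => by
    obtain ⟨e, y, rfl⟩ := M.exists_mulE w x
    have wc := (M.subst_compat w hc ⟨e.1, e.2.trans hc.root.symm⟩).2
    rw [M.leafPath_node, M.expand_cons,
      ← leafPath_subst (ch e) (w e).2 _ (hc.child e) wc y
        ⟨y.1, y.2.trans (M.subst_tot (w e).2 (hc.child e) wc).symm⟩ rfl]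
    refine Eq.trans ?_ (M.leafPath_graft (c []).1 (c []).2 _ (M.subst_compat w hc) w' _ _)
    exact M.leafPath_congr rfl _ _ (hx.symm.trans (M.graftIn_subst w hc e y _ rfl).symm)

theorem Matches.graft_in {T : PreTree M.toPolyEndo} {w : T.WF}
    {f : M.Fib (M.tot T w).1 → PreTree M.toPolyEndo} {d : List M.E → M.Tree}
    (hd : M.Matches (M.graft T w f) d) : M.Matches T d :=
  fun l b h => hd l b (M.nodeAt_graft_in T w f h)

theorem Matches.graft_out {T : PreTree M.toPolyEndo} {w : T.WF}
    {f : M.Fib (M.tot T w).1 → PreTree M.toPolyEndo} {d : List M.E → M.Tree}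
    (hd : M.Matches (M.graft T w f) d) (x : M.Fib (M.tot T w).1) :
    M.Matches (f x) (fun l => d (M.leafPath T w x ++ l)) :=
  fun l b h => hd _ b (M.nodeAt_graft_out T w f x h)

theorem subst_graft : ∀ (T : PreTree M.toPolyEndo) (w : T.WF)
    (f : M.Fib (M.tot T w).1 → PreTree M.toPolyEndo)
    (hf : ∀ x, (f x).root = M.s x.1 ∧ (f x).WF) (d : List M.E → M.Tree)
    (hd : M.Matches (M.graft T w f) d) (w' : (M.subst T d (Matches.graft_in M hd)).WF),
    M.subst (M.graft T w f) d hd =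
      M.graft (M.subst T d (Matches.graft_in M hd)) w' fun x =>
        M.subst (f ⟨x.1, x.2.trans (M.subst_tot w _ _)⟩)
          (fun l => d (M.leafPath T w ⟨x.1, x.2.trans (M.subst_tot w _ _)⟩ ++ l))
          (Matches.graft_out M hd _)
  | edge i, _, f, hf, d, hd, _ => rfl
  | node b ch, w, f, hf, d, hd, w' => by
    have hd' : M.Matches (node b ch) d := Matches.graft_in M hd
    refine Eq.trans ?_ (M.graft_graft (d []).1 (d []).2 _ (M.subst_compat w hd') w' _).symm
    refine M.graft_congr rfl _ _ fun x x' hx => ?_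
    obtain rfl := Subtype.ext hx
    have e : M.Fib b := ⟨x.1, x.2.trans hd'.root⟩
    refine (subst_graft (ch ⟨x.1, x.2.trans hd'.root⟩) (w _).2 _ (M.compat_child w hf _) _
      (hd.child ⟨x.1, x.2.trans hd'.root⟩) (M.subst_compat w hd' x).2).trans ?_
    refine M.graft_congr rfl _ _ fun y y' hy => ?_
    obtain rfl := Subtype.ext hy
    have key := (M.graftIn_subst w hd' ⟨x.1, x.2.trans hd'.root⟩
      ⟨y.1, y.2.trans (M.subst_tot (w _).2 _ _)⟩ y rfl).symm
    refine M.subst_congr (congrArg f (Subtype.ext key)) _ _ fun l b' _ => ?_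
    congr 1
    rw [← List.cons_append]
    congr 1
    refine (M.leafPath_node w ⟨x.1, x.2.trans hd'.root⟩ _).symm.trans ?_
    exact M.leafPath_congr rfl _ _ key

theorem expand_graft_in : ∀ (T : PreTree M.toPolyEndo) (w : T.WF)
    (f : M.Fib (M.tot T w).1 → PreTree M.toPolyEndo) (d : List M.E → M.Tree)
    (hd : M.Matches (M.graft T w f) d) {l : List M.E} {b : M.B} (_ : T.NodeAt l b),
    M.expand (M.graft T w f) d hd l = M.expand T d (Matches.graft_in M hd) l
  | edge i, _, _, _, _, _, _, h => h.elim
  | node b ch, w, _, _, _, [], _, _ => rfl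
  | node b ch, w, f, d, hd, e :: l, b', ⟨he, h⟩ => by
    refine (M.expand_cons hd ⟨e, he⟩ l).trans ?_
    rw [M.expand_cons (Matches.graft_in M hd) ⟨e, he⟩ l]
    congr 1
    exact expand_graft_in (ch ⟨e, he⟩) (w _).2 _ _ (hd.child ⟨e, he⟩) h

theorem expand_graft_out : ∀ (T : PreTree M.toPolyEndo) (w : T.WF)
    (f : M.Fib (M.tot T w).1 → PreTree M.toPolyEndo) (d : List M.E → M.Tree)
    (hd : M.Matches (M.graft T w f) d) (x : M.Fib (M.tot T w).1) (l : List M.E),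
    M.expand (M.graft T w f) d hd (M.leafPath T w x ++ l) =
      M.expand T d (Matches.graft_in M hd) (M.leafPath T w x) ++
        M.expand (f x) (fun l => d (M.leafPath T w x ++ l)) (Matches.graft_out M hd x) l
  | edge i, _, f, _, _, x, _ => by
    obtain rfl := M.unitE_unique i x
    rfl
  | node b ch, w, f, d, hd, x, l => by
    obtain ⟨e, y, rfl⟩ := M.exists_mulE w x
    have h := M.leafPath_node w e y
    have h1 : M.expand (M.graft (node b ch) w f) d hd (e.1 :: (M.leafPath (ch e) (w e).2 y ++ l)) =
      M.expand (node b ch) d (Matches.graft_in M hd) (e.1 :: M.leafPath (ch e) (w e).2 y) ++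
        M.expand (f (M.mulE (M.level b ch w) ⟨e, y⟩))
          (fun l => d (e.1 :: (M.leafPath (ch e) (w e).2 y ++ l)))
          (Matches.graft_out M (hd.child e) y) l := by
      refine (M.expand_cons hd e _).trans ?_
      rw [M.expand_cons, List.append_assoc]
      congr 1
      exact expand_graft_out (ch e) (w e).2 _ _ (hd.child e) y l
    refine (congrArg (fun q => M.expand (M.graft (node b ch) w f) d hd (q ++ l)) h).trans
      (h1.trans ?_)
    refine congrArg₂ (· ++ ·) (congrArg _ h.symm) ?_
    refine M.expand_congr rfl _ _ (fun l b' _ => ?_) l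
    rw [h, List.cons_append]

theorem nodeAt_subst_of : ∀ (T : PreTree M.toPolyEndo) (c : List M.E → M.Tree)
    (hc : M.Matches T c) {l m : List M.E} {b b' : M.B} (_ : T.NodeAt l b)
    (_ : (c l).1.NodeAt m b'), (M.subst T c hc).NodeAt (M.expand T c hc l ++ m) b'
  | edge _, _, _, _, _, _, _, h, _ => h.elim
  | node b ch, c, hc, [], m, _, b', h, h' => M.nodeAt_graft_in _ _ _ h'
  | node b ch, c, hc, e :: l, m, b1, b', ⟨he, h⟩, h' => by
    rw [M.expand_cons hc ⟨e, he⟩, List.append_assoc]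
    refine M.nodeAt_graft_out _ _ _ _ ?_
    exact nodeAt_subst_of (ch ⟨e, he⟩) (fun l => c (e :: l)) (hc.child ⟨e, he⟩) h h'

theorem exists_of_nodeAt_subst : ∀ (T : PreTree M.toPolyEndo) (c : List M.E → M.Tree)
    (hc : M.Matches T c) {q : List M.E} {b' : M.B} (_ : (M.subst T c hc).NodeAt q b'),
    ∃ l b m, T.NodeAt l b ∧ (c l).1.NodeAt m b' ∧ q = M.expand T c hc l ++ m
  | edge _, _, _, _, _, h => h.elim
  | node b ch, c, hc, q, b', h => by
    obtain h | ⟨x, l, rfl, h9⟩ := M.nodeAt_graft _ _ _ h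
    · exact ⟨[], b, q, rfl, h, rfl⟩
    · obtain ⟨l, b1, m, h1, h2, rfl⟩ := exists_of_nodeAt_subst _ _ _ h9
      refine ⟨x.1 :: l, b1, m, ⟨x.2.trans hc.root, h1⟩, h2, ?_⟩
      rw [M.expand_cons hc ⟨x.1, x.2.trans hc.root⟩, List.append_assoc]

theorem expand_inj : ∀ (T : PreTree M.toPolyEndo) (c : List M.E → M.Tree)
    (hc : M.Matches T c) {l m l' m' : List M.E} {b b1 b' b1' : M.B} (_ : T.NodeAt l b)
    (_ : (c l).1.NodeAt m b1) (_ : T.NodeAt l' b') (_ : (c l').1.NodeAt m' b1')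
    (_ : M.expand T c hc l ++ m = M.expand T c hc l' ++ m'), l = l' ∧ m = m'
  | edge _, _, _, _, _, _, _, _, _, _, _, h, _, _, _, _ => h.elim
  | node b ch, c, hc, [], m, [], m', _, _, _, _, _, _, _, _, h => ⟨rfl, h⟩
  | node b ch, c, hc, [], m, e :: l, m', _, _, _, _, _, h, ⟨he, _⟩, _, hh => by
    rw [M.expand_cons hc ⟨e, he⟩, List.append_assoc] at hh
    obtain rfl : m = _ := hh
    exact (M.not_nodeAt_leafPath _ _ _ _ _ h).elim
  | node b ch, c, hc, e :: l, m', [], m, _, _, _, _, ⟨he, _⟩, _, _, h, hh => by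
    rw [M.expand_cons hc ⟨e, he⟩, List.append_assoc] at hh
    obtain rfl : _ = m := hh
    exact (M.not_nodeAt_leafPath _ _ _ _ _ h).elim
  | node b ch, c, hc, e :: l, m, e' :: l', m', _, _, _, _, ⟨he, h1⟩, h2, ⟨he', h3⟩, h4, hh => by
    rw [M.expand_cons hc ⟨e, he⟩, M.expand_cons hc ⟨e', he'⟩, List.append_assoc,
      List.append_assoc] at hh
    obtain ⟨hx, hh⟩ := M.leafPath_inj _ _ _ _ _ _ hh
    obtain rfl : e = e' := congrArg Subtype.val hx
    obtain ⟨rfl, rfl⟩ := expand_inj _ _ _ h1 h2 h3 h4 hh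
    exact ⟨rfl, rfl⟩

theorem Matches.inner {T : PreTree M.toPolyEndo} {c : List M.E → M.Tree} {hc : M.Matches T c}
    {d : List M.E → M.Tree} (hd : M.Matches (M.subst T c hc) d) {l : List M.E} {b : M.B}
    (h : T.NodeAt l b) : M.Matches (c l).1 (fun m => d (M.expand T c hc l ++ m)) :=
  fun _ b' h' => hd _ b' (M.nodeAt_subst_of T c hc h h')

theorem subst_subst : ∀ (T : PreTree M.toPolyEndo) (w : T.WF) (c : List M.E → M.Tree)
    (hc : M.Matches T c) (d : List M.E → M.Tree) (hd : M.Matches (M.subst T c hc) d)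
    (cd : List M.E → M.Tree) (hcd : M.Matches T cd)
    (_ : ∀ l b (h : T.NodeAt l b), (cd l).1 = M.subst (c l).1 _ (Matches.inner M hd h)),
    M.subst (M.subst T c hc) d hd = M.subst T cd hcd
  | edge _, _, _, _, _, _, _, _, _ => rfl
  | node b ch, w, c, hc, d, hd, cd, hcd, h => by
    have h0 := h [] b rfl
    have hm : M.Matches (c []).1 d := Matches.graft_in M hd
    refine (M.subst_graft (c []).1 (c []).2 _ (M.subst_compat w hc) d hd
      (M.subst_wf (c []).2 _)).trans ?_
    refine M.graft_congr h0.symm _ _ fun x x' hx => ?_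
    obtain ⟨x, hx1⟩ := x
    obtain ⟨x', hx2⟩ := x'
    obtain rfl : x = x' := hx
    have he : M.p x = b := hx2.trans hcd.root
    refine subst_subst (ch ⟨x, he⟩) (w _).2 _ (hc.child ⟨x, he⟩) _ _ _ _ fun l b' hl => ?_
    refine (h (x :: l) b' ⟨he, hl⟩).trans ?_
    refine M.subst_congr rfl _ _ fun m b2 hm => ?_
    rw [M.expand_cons hc ⟨x, he⟩, List.append_assoc]

theorem expand_subst : ∀ (T : PreTree M.toPolyEndo) (w : T.WF) (c : List M.E → M.Tree)
    (hc : M.Matches T c) (d : List M.E → M.Tree) (hd : M.Matches (M.subst T c hc) d)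
    (cd : List M.E → M.Tree) (hcd : M.Matches T cd)
    (_ : ∀ l b (h : T.NodeAt l b), (cd l).1 = M.subst (c l).1 _ (Matches.inner M hd h))
    {l m : List M.E} {b b' : M.B} (hl : T.NodeAt l b) (_ : (c l).1.NodeAt m b'),
    M.expand (M.subst T c hc) d hd (M.expand T c hc l ++ m) =
      M.expand T cd hcd l ++ M.expand (c l).1 _ (Matches.inner M hd hl) m
  | edge _, _, _, _, _, _, _, _, _, _, _, _, _, h, _ => h.elim
  | node b ch, w, c, hc, d, hd, cd, hcd, h, [], m, _, _, hl, hm =>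
    M.expand_graft_in _ _ _ _ _ hm
  | node b ch, w, c, hc, d, hd, cd, hcd, h, e :: l, m, b1, b2, ⟨he, hl⟩, hm => by
    have h0 := h [] b rfl
    have hm' : M.Matches (c []).1 d := Matches.graft_in M hd
    have ih := expand_subst (ch ⟨e, he⟩) (w _).2 (fun l => c (e :: l)) (hc.child ⟨e, he⟩)
      (fun l => d (M.leafPath (c []).1 (c []).2 ⟨e, he.trans hc.root.symm⟩ ++ l))
      (Matches.graft_out M hd ⟨e, he.trans hc.root.symm⟩) (fun l => cd (e :: l))
      (hcd.child ⟨e, he⟩) (fun l b' hl => by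
        refine (h (e :: l) b' ⟨he, hl⟩).trans ?_
        refine M.subst_congr rfl _ _ fun m b2 hm => ?_
        rw [M.expand_cons hc ⟨e, he⟩, List.append_assoc]) hl hm
    rw [M.expand_cons hcd ⟨e, he⟩, List.append_assoc]
    have h1 : M.expand (c (e :: l)).1 _ (Matches.inner M hd (l := e :: l) ⟨he, hl⟩) m =
        M.expand (c (e :: l)).1
          (fun m => d (M.leafPath (c []).1 (c []).2 ⟨e, he.trans hc.root.symm⟩ ++
            (M.expand (ch ⟨e, he⟩) (fun l => c (e :: l)) (hc.child ⟨e, he⟩) l ++ m)))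
          (Matches.inner M (Matches.graft_out M hd ⟨e, he.trans hc.root.symm⟩) hl) m :=
      M.expand_congr rfl _ _ (fun m b2 hm => by
        rw [M.expand_cons hc ⟨e, he⟩, List.append_assoc]) m
    rw [h1, M.expand_cons hc ⟨e, he⟩, List.append_assoc]
    refine (M.expand_graft_out (c []).1 (c []).2 _ d hd ⟨e, he.trans hc.root.symm⟩ _).trans ?_
    refine congrArg₂ (· ++ ·) ?_ ih
    rw [← M.leafPath_subst (c []).1 (c []).2 d hm' (M.subst_wf (c []).2 _)
      ⟨e, he.trans hc.root.symm⟩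
      ⟨e, (he.trans hc.root.symm).trans (M.subst_tot (c []).2 hm' _).symm⟩ rfl]
    exact M.leafPath_congr h0.symm _ _ rfl

/-- The set `tr•(P)` of `P`-trees with a marked node. -/
structure MarkedTree where
  tree : M.Tree
  path : List M.E
  op : M.B
  isNode : tree.1.NodeAt path op

theorem MarkedTree.eq_of {M : PolyMonad.{u}} {x y : M.MarkedTree} (h : x.tree = y.tree)
    (h' : x.path = y.path) : x = y := by
  obtain ⟨T, l, b, n⟩ := x
  obtain ⟨T', l', b', n'⟩ := y
  obtain rfl : T = T' := h
  obtain rfl : l = l' := h'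
  obtain rfl := n.unique n'
  rfl

theorem MarkedTree.nodeAt {M : PolyMonad.{u}} (x : M.MarkedTree) {T : M.Tree} (h : x.tree = T) :
    T.1.NodeAt x.path x.op := by
  subst h
  exact x.isNode

/-- The diagram `B ← tr•(P) → tr(P) → B`: decoration of the marked node, forgetful map, total contraction. -/
def bdEndo : PolyEndo.{u} where
  I := M.B
  B := M.Tree
  E := M.MarkedTree
  s := MarkedTree.op
  p := MarkedTree.tree
  t := M.total
  finite_fib T := by
    have := (finite_nodes T.1).to_subtype
    exact Finite.of_injective
      (fun x : {e : M.MarkedTree // e.tree = T} =>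
        (⟨x.1.path, x.1.op, x.1.nodeAt x.2⟩ : {l : List M.E | ∃ b, T.1.NodeAt l b}))
      fun x y h => Subtype.ext (MarkedTree.eq_of (x.2.trans y.2.symm) (congrArg Subtype.val h))

/-- The tree `T` with its node at address `l` marked. -/
def mark (T : M.Tree) {l : List M.E} {b : M.B} (h : T.1.NodeAt l b) : M.bdEndo.Fib T :=
  ⟨⟨T, l, b, h⟩, rfl⟩

open Classical in
/-- A two-level tree of the endofunctor above, read as an assignment of a tree to each node of a tree. -/
noncomputable def filling (x : M.bdEndo.TwoLevel) (l : List M.E) : M.Tree :=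
  if h : ∃ b, x.op.1.NodeAt l b then x.top (M.mark x.op h.choose_spec) else x.op

theorem filling_eq (x : M.bdEndo.TwoLevel) {l : List M.E} {b : M.B} (h : x.op.1.NodeAt l b) :
    M.filling x l = x.top (M.mark x.op h) := by
  have h' : ∃ b, x.op.1.NodeAt l b := ⟨b, h⟩
  refine (dif_pos h').trans ?_
  exact congrArg x.top (Subtype.ext (MarkedTree.eq_of rfl rfl))

theorem filling_eq' (x : M.bdEndo.TwoLevel) (e : M.bdEndo.Fib x.op) :
    M.filling x e.1.path = x.top e := by
  obtain ⟨⟨T, l, b, n⟩, h⟩ := e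
  obtain rfl : T = x.op := h
  exact M.filling_eq x n

theorem isNode_of_fib {T : M.Tree} (e : M.bdEndo.Fib T) : T.1.NodeAt e.1.path e.1.op :=
  e.1.nodeAt e.2

theorem filling_matches (x : M.bdEndo.TwoLevel) : M.Matches x.op.1 (M.filling x) := by
  intro l b h
  rw [M.filling_eq x h]
  exact x.compat (M.mark x.op h)

/-- The multiplication: substitution of trees into the nodes of a tree. -/
noncomputable def bdMul (x : M.bdEndo.TwoLevel) : M.Tree :=
  ⟨M.subst x.op.1 (M.filling x) (M.filling_matches x), M.subst_wf x.op.2 _⟩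

/-- A node of a tree substituted into a node of `T` is a node of the resulting tree. -/
noncomputable def bdMulE (x : M.bdEndo.TwoLevel)
    (q : Σ e : M.bdEndo.Fib x.op, M.bdEndo.Fib (x.top e)) : M.bdEndo.Fib (M.bdMul x) :=
  M.mark (M.bdMul x)
    (l := M.expand x.op.1 (M.filling x) (M.filling_matches x) q.1.1.path ++ q.2.1.path)
    (b := q.2.1.op)
    (M.nodeAt_subst_of _ _ _ (M.isNode_of_fib q.1) (by
      rw [M.filling_eq' x q.1]
      exact M.isNode_of_fib q.2))

theorem bdMulE_bijective (x : M.bdEndo.TwoLevel) : Function.Bijective (M.bdMulE x) := by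
  constructor
  · rintro ⟨e, f⟩ ⟨e', f'⟩ h
    have h1 : M.expand x.op.1 (M.filling x) (M.filling_matches x) e.1.path ++ f.1.path =
      M.expand x.op.1 (M.filling x) (M.filling_matches x) e'.1.path ++ f'.1.path :=
      congrArg (fun z => z.1.path) h
    obtain ⟨h2, h3⟩ := M.expand_inj _ _ _ (M.isNode_of_fib e)
      (by rw [M.filling_eq' x e]; exact M.isNode_of_fib f) (M.isNode_of_fib e')
      (by rw [M.filling_eq' x e']; exact M.isNode_of_fib f') h1
    obtain rfl : e = e' := Subtype.ext (MarkedTree.eq_of (e.2.trans e'.2.symm) h2)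
    obtain rfl : f = f' := Subtype.ext (MarkedTree.eq_of (f.2.trans f'.2.symm) h3)
    rfl
  · intro g
    obtain ⟨l, b, m, h1, h2, h3⟩ := M.exists_of_nodeAt_subst _ _ _ (M.isNode_of_fib g)
    rw [M.filling_eq x h1] at h2
    refine ⟨⟨M.mark x.op h1, M.mark _ h2⟩, Subtype.ext (MarkedTree.eq_of g.2.symm h3.symm)⟩

/-- The tree with exactly one node, decorated by `b`. -/
def corolla (b : M.B) : M.Tree :=
  ⟨node b fun e => edge (M.s e.1), fun _ => ⟨rfl, trivial⟩⟩

theorem total_corolla (b : M.B) : M.total (M.corolla b) = b := M.mul_unit b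

theorem graft_corolla {b : M.B} (w) (f : M.Fib (M.tot (M.corolla b).1 w).1 → PreTree M.toPolyEndo)
    (f' : M.Fib b → PreTree M.toPolyEndo) (h : ∀ x x', x.1 = x'.1 → f x = f' x') :
    M.graft (M.corolla b).1 w f = node b f' := by
  change node b _ = node b f'
  congr 1
  funext e
  exact h _ _ (M.mulE_unit b e)

theorem leafPath_corolla {b : M.B} (w) (x : M.Fib (M.tot (M.corolla b).1 w).1) :
    M.leafPath (M.corolla b).1 w x = [x.1] := by
  obtain ⟨e, y, rfl⟩ := M.exists_mulE (b := b) w x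
  refine (M.leafPath_node w e y).trans ?_
  obtain rfl := M.unitE_unique _ y
  exact congrArg (fun z => [z]) (M.mulE_unit b e).symm

theorem subst_corolla : ∀ (T : PreTree M.toPolyEndo) (c : List M.E → M.Tree)
    (hc : M.Matches T c) (_ : ∀ l b, T.NodeAt l b → c l = M.corolla b), M.subst T c hc = T
  | edge _, _, _, _ => rfl
  | node b ch, c, hc, h => by
    have h0 := h [] b rfl
    refine (M.graft_congr (congrArg Subtype.val h0) _ (M.corolla b).2
      (f' := fun x => ch ⟨x.1, x.2.trans (M.total_corolla b)⟩) fun x x' hx => ?_).trans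
      (M.graft_corolla _ _ _ fun x x' hx => congrArg ch (Subtype.ext hx))
    refine (subst_corolla _ _ _ fun l b' hl => h (x.1 :: l) b' ⟨_, hl⟩).trans ?_
    exact congrArg ch (Subtype.ext hx)

theorem expand_corolla : ∀ (T : PreTree M.toPolyEndo) (c : List M.E → M.Tree)
    (hc : M.Matches T c) (_ : ∀ l b, T.NodeAt l b → c l = M.corolla b) {l : List M.E} {b : M.B}
    (_ : T.NodeAt l b), M.expand T c hc l = l
  | edge _, _, _, _, _, _, hl => hl.elim
  | node b ch, c, hc, h, [], _, _ => rfl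
  | node b ch, c, hc, h, e :: l, b1, ⟨he, hl⟩ => by
    have h0 := h [] b rfl
    rw [M.expand_cons hc ⟨e, he⟩,
      expand_corolla (ch ⟨e, he⟩) _ _ (fun l b' hl => h (e :: l) b' ⟨_, hl⟩) hl]
    refine congrArg (· ++ l) ((M.leafPath_congr (congrArg Subtype.val h0) _ (M.corolla b).2
      (x' := ⟨e, he.trans (M.total_corolla b).symm⟩) rfl).trans (M.leafPath_corolla _ _))

theorem corolla_subst {b : M.B} (T : M.Tree) (c : List M.E → M.Tree)
    (hc : M.Matches (M.corolla b).1 c) (h : c [] = T) : M.subst (M.corolla b).1 c hc = T.1 := by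
  refine (M.graft_congr (congrArg Subtype.val h) _ T.2 (f' := fun x => edge (M.s x.1))
    fun x x' hx => ?_).trans (M.graft_edge T.1 T.2)
  exact congrArg (fun z => edge (M.s z)) hx

/-- Auxiliary: substitute in the trees of the upper level first. -/
noncomputable def bdLevel (x : M.bdEndo.TwoLevel) (d : M.bdEndo.Fib (M.bdMul x) → M.Tree)
    (hd : ∀ g, M.total (d g) = g.1.op) : M.bdEndo.TwoLevel :=
  ⟨x.op, fun e => M.bdMul ⟨x.top e, fun f => d (M.bdMulE x ⟨e, f⟩),
    fun f => hd (M.bdMulE x ⟨e, f⟩)⟩, fun e => (M.subst_tot (x.top e).2 _ _).trans (x.compat e)⟩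

theorem filling_level (x : M.bdEndo.TwoLevel) (d : M.bdEndo.Fib (M.bdMul x) → M.Tree)
    (hd : ∀ g, M.total (d g) = g.1.op) (l b) (h : x.op.1.NodeAt l b) :
    (M.filling (M.bdLevel x d hd) l).1 = M.subst (M.filling x l).1 _
      (Matches.inner M (M.filling_matches ⟨M.bdMul x, d, hd⟩) h) := by
  refine (congrArg Subtype.val (M.filling_eq (M.bdLevel x d hd) h)).trans ?_
  refine M.subst_congr (congrArg Subtype.val (M.filling_eq x h).symm) _ _ fun m b' hm => ?_
  rw [M.filling_eq _ hm]
  exact (M.filling_eq' ⟨M.bdMul x, d, hd⟩ (M.bdMulE x ⟨M.mark x.op h, M.mark _ hm⟩)).symm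

/-- The Baez–Dolan construction: the polynomial monad `P⁺` whose types are the operations of `P`, whose
operations are the `P`-trees, whose inputs are the nodes of trees, whose unit is given by the one-node
trees and whose multiplication is the substitution of trees into nodes. -/
noncomputable def bd : PolyMonad.{u} where
  toPolyEndo := M.bdEndo
  unit := M.corolla
  t_unit := M.total_corolla
  unitE b := M.mark (M.corolla b) (l := []) (b := b) rfl
  unitE_unique b e := by
    refine Subtype.ext (MarkedTree.eq_of e.2 ?_)
    have h := M.isNode_of_fib e
    generalize e.1.path = l at h
    cases l with
    | nil => rfl
    | cons a l => exact h.2.elim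
  s_unitE b := rfl
  mul := M.bdMul
  t_mul x := M.subst_tot x.op.2 _ _
  mulE x := Equiv.ofBijective (M.bdMulE x) (M.bdMulE_bijective x)
  s_mulE x e f := rfl
  unit_mul b c hc := Subtype.ext <| M.corolla_subst _ _ (M.filling_matches ⟨M.corolla b, c, hc⟩) <| M.filling_eq _ _
  unit_mulE b c hc f :=
    MarkedTree.eq_of ((Subtype.ext <| M.corolla_subst _ _ (M.filling_matches ⟨M.corolla b, c, hc⟩) <| M.filling_eq _ _).trans f.2.symm) rfl
  mul_unit T := Subtype.ext <| M.subst_corolla _ _ _ fun l b h => M.filling_eq _ h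
  mulE_unit T e := by
    refine MarkedTree.eq_of ?_ ?_
    · exact Eq.trans (Subtype.ext <| M.subst_corolla _ _ _ fun l b h => M.filling_eq _ h) e.2.symm
    · refine (List.append_nil _).trans ?_
      exact M.expand_corolla _ _ _ (fun l b h => M.filling_eq _ h) (M.isNode_of_fib e)
  assoc x d hd := Subtype.ext <|
    M.subst_subst _ x.op.2 _ _ _ _ _ (M.filling_matches (M.bdLevel x d hd)) (M.filling_level x d hd)
  assocE x d hd e f g := by
    refine MarkedTree.eq_of (Subtype.ext <|
      M.subst_subst _ x.op.2 _ _ _ _ _ (M.filling_matches (M.bdLevel x d hd))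
        (M.filling_level x d hd)) ?_
    have he := M.isNode_of_fib e
    have hf := M.isNode_of_fib f
    have hx := M.filling_eq' x e
    have hf' : (M.filling x e.1.path).1.NodeAt f.1.path f.1.op := by
      rw [hx]
      exact hf
    have h1 := M.expand_subst _ x.op.2 _ _ _ (M.filling_matches ⟨M.bdMul x, d, hd⟩) _
      (M.filling_matches (M.bdLevel x d hd)) (M.filling_level x d hd) he hf'
    refine (congrArg (· ++ g.1.path) h1).trans ((List.append_assoc _ _ _).trans ?_)
    refine congrArg₂ (· ++ ·) rfl (congrArg (· ++ g.1.path) ?_)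
    refine M.expand_congr (congrArg Subtype.val hx) _ _ (fun m b' hm => ?_) _
    rw [hx] at hm
    refine Eq.trans ?_ (M.filling_eq _ hm).symm
    exact M.filling_eq' ⟨M.bdMul x, d, hd⟩ (M.bdMulE x ⟨e, M.mark _ hm⟩)

end PolyMonad

/-- A morphism of polynomial endofunctors: maps between the representing diagrams, with cartesian
middle square. -/
structure PolyHom (P Q : PolyEndo.{u}) where
  onI : P.I → Q.I
  onB : P.B → Q.B
  onE : P.E → Q.E
  s_onE : ∀ e, Q.s (onE e) = onI (P.s e)
  p_onE : ∀ e, Q.p (onE e) = onB (P.p e)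
  t_onB : ∀ b, Q.t (onB b) = onI (P.t b)
  cartesian : ∀ b, Function.Bijective
    (fun e : P.Fib b => (⟨onE e.1, (p_onE e.1).trans (congrArg onB e.2)⟩ : Q.Fib (onB b)))

namespace PolyHom

variable {P Q : PolyEndo.{u}} (f : PolyHom P Q)

/-- The bijection from the inputs of `b` to the inputs of its image. -/
def fib {b : P.B} (e : P.Fib b) : Q.Fib (f.onB b) :=
  ⟨f.onE e.1, (f.p_onE e.1).trans (congrArg f.onB e.2)⟩

/-- The inverse of `fib`. -/
noncomputable def lift {b : P.B} : Q.Fib (f.onB b) → P.Fib b :=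
  (Equiv.ofBijective _ (f.cartesian b)).symm

theorem lift_fib {b : P.B} (e : P.Fib b) : f.lift (f.fib e) = e :=
  (Equiv.ofBijective _ (f.cartesian b)).symm_apply_apply e

theorem fib_lift {b : P.B} (e : Q.Fib (f.onB b)) : f.fib (f.lift e) = e :=
  (Equiv.ofBijective _ (f.cartesian b)).apply_symm_apply e

theorem onE_lift {b : P.B} (e : Q.Fib (f.onB b)) : f.onE (f.lift e).1 = e.1 :=
  congrArg Subtype.val (f.fib_lift e)

theorem exists_lift {b : P.B} {e : Q.E} (h : Q.p e = f.onB b) :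
    ∃ e' : P.Fib b, e = f.onE e'.1 := ⟨f.lift ⟨e, h⟩, (f.onE_lift ⟨e, h⟩).symm⟩

theorem onE_inj {b : P.B} {e e' : P.Fib b} (h : f.onE e.1 = f.onE e'.1) : e = e' :=
  (f.cartesian b).1 (Subtype.ext h)

/-- `y` is the image of the two-level tree `x`. -/
structure IsImage (x : P.TwoLevel) (y : Q.TwoLevel) : Prop where
  op : y.op = f.onB x.op
  top : ∀ (e : P.Fib x.op) (e' : Q.Fib y.op), e'.1 = f.onE e.1 → y.top e' = f.onB (x.top e)

/-- The image of a two-level tree. -/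
noncomputable def image (x : P.TwoLevel) : Q.TwoLevel where
  op := f.onB x.op
  top e := f.onB (x.top (f.lift e))
  compat e := by rw [f.t_onB, x.compat, ← f.s_onE, f.onE_lift]

theorem isImage_image (x : P.TwoLevel) : f.IsImage x (f.image x) where
  op := rfl
  top e e' h := by
    obtain rfl : e' = f.fib e := Subtype.ext h
    exact congrArg (fun z => f.onB (x.top z)) (f.lift_fib e)

end PolyHom

namespace PolyMonad

/-- A morphism of polynomial monads: a morphism of the underlying polynomial endofunctors which
respects units and multiplication, on operations and on inputs. (For units the latter is automatic,
as a unit has only one input.) -/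
structure Hom (M N : PolyMonad.{u}) extends PolyHom M.toPolyEndo N.toPolyEndo where
  onB_unit : ∀ i, onB (M.unit i) = N.unit (onI i)
  onB_mul : ∀ x y, toPolyHom.IsImage x y → onB (M.mul x) = N.mul y
  onE_mulE : ∀ x y, toPolyHom.IsImage x y → ∀ (e : M.Fib x.op) (f : M.Fib (x.top e))
    (e' : N.Fib y.op) (f' : N.Fib (y.top e')), e'.1 = onE e.1 → f'.1 = onE f.1 →
    onE (M.mulE x ⟨e, f⟩).1 = (N.mulE y ⟨e', f'⟩).1

theorem Hom.ext_of {M N : PolyMonad.{u}} {f g : Hom M N} (hI : ∀ i, f.onI i = g.onI i)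
    (hB : ∀ b, f.onB b = g.onB b) (hE : ∀ e, f.onE e = g.onE e) : f = g := by
  obtain ⟨⟨fI, fB, fE, _, _, _, _⟩, _, _, _⟩ := f
  obtain ⟨⟨gI, gB, gE, _, _, _, _⟩, _, _, _⟩ := g
  obtain rfl : fI = gI := funext hI
  obtain rfl : fB = gB := funext hB
  obtain rfl : fE = gE := funext hE
  rfl

def Hom.id (M : PolyMonad.{u}) : Hom M M where
  onI := _root_.id
  onB := _root_.id
  onE := _root_.id
  s_onE _ := rfl
  p_onE _ := rfl
  t_onB _ := rfl
  cartesian _ := Function.bijective_id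
  onB_unit _ := rfl
  onB_mul x y h :=
    congrArg M.mul (PolyEndo.TwoLevel.ext_fib h.op.symm fun e he he' =>
      (h.top ⟨e, he⟩ ⟨e, he'⟩ rfl).symm)
  onE_mulE x y h e f e' f' he hf :=
    M.mulE_congr (PolyEndo.TwoLevel.ext_fib h.op.symm fun e he he' =>
      (h.top ⟨e, he⟩ ⟨e, he'⟩ rfl).symm) he.symm hf.symm

def Hom.comp {M N K : PolyMonad.{u}} (f : Hom M N) (g : Hom N K) : Hom M K where
  onI i := g.onI (f.onI i)
  onB b := g.onB (f.onB b)
  onE e := g.onE (f.onE e)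
  s_onE e := (g.s_onE _).trans (congrArg g.onI (f.s_onE e))
  p_onE e := (g.p_onE _).trans (congrArg g.onB (f.p_onE e))
  t_onB b := (g.t_onB _).trans (congrArg g.onI (f.t_onB b))
  cartesian b := (g.cartesian (f.onB b)).comp (f.cartesian b)
  onB_unit i := (congrArg g.onB (f.onB_unit i)).trans (g.onB_unit _)
  onB_mul x y h := by
    refine (congrArg g.onB (f.onB_mul x _ (f.isImage_image x))).trans (g.onB_mul _ _ ⟨h.op, ?_⟩)
    intro e e' he
    exact h.top (f.lift e) e' (he.trans (congrArg g.onE (f.onE_lift e).symm))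
  onE_mulE x y h e k e' k' he hk := by
    have hi := f.isImage_image x
    have htop := hi.top e (f.fib e) rfl
    refine (congrArg g.onE (f.onE_mulE x _ hi e k (f.fib e)
      ⟨f.onE k.1, (f.fib k).2.trans htop.symm⟩ rfl rfl)).trans
      (g.onE_mulE _ _ ⟨h.op, ?_⟩ _ _ _ _ he hk)
    intro e e' he
    exact h.top (f.lift e) e' (he.trans (congrArg g.onE (f.onE_lift e).symm))

/-- The category of polynomial monads. -/
instance : CategoryTheory.Category PolyMonad.{u} where
  Hom := Hom
  id := Hom.id
  comp := Hom.comp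

open PreTree

variable {M N : PolyMonad.{u}} (f : Hom M N)

/-- The effect of a monad morphism on trees: apply it to the decoration of every edge and node. -/
noncomputable def mapTree : PreTree M.toPolyEndo → PreTree N.toPolyEndo
  | edge i => edge (f.onI i)
  | node b ch => node (f.onB b) fun e => mapTree (ch (f.lift e))

theorem root_mapTree (T : PreTree M.toPolyEndo) : (mapTree f T).root = f.onI T.root := by
  cases T with
  | edge i => rfl
  | node b ch => exact f.t_onB b

theorem mapTree_wf : ∀ {T : PreTree M.toPolyEndo} (_ : T.WF), (mapTree f T).WF
  | edge i, _ => trivial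
  | node b ch, w => fun e =>
    ⟨by rw [root_mapTree, (w _).1, ← f.s_onE, f.onE_lift], mapTree_wf (w _).2⟩

theorem mapTree_child (b : M.B) (ch : M.Fib b → PreTree M.toPolyEndo) (e : M.Fib b) :
    mapTree f (ch (f.lift (f.fib e))) = mapTree f (ch e) := by rw [f.lift_fib]

theorem isImage_level_of {b : M.B} {ch : M.Fib b → PreTree M.toPolyEndo} (w : (node b ch).WF)
    (w' : (mapTree f (node b ch)).WF)
    (h : ∀ e : M.Fib b, ∀ w', (N.tot (mapTree f (ch e)) w').1 = f.onB (M.tot (ch e) (w e).2).1) :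
    f.IsImage (M.level b ch w) (N.level (f.onB b) (fun e => mapTree f (ch (f.lift e))) w') where
  op := rfl
  top e e' he := by
    obtain rfl : e' = f.fib e := Subtype.ext he
    exact (N.tot_congr (mapTree_child f b ch e) _ (mapTree_wf f (w e).2)).trans (h e _)

theorem tot_mapTree : ∀ (T : PreTree M.toPolyEndo) (w : T.WF) (w' : (mapTree f T).WF),
    (N.tot (mapTree f T) w').1 = f.onB (M.tot T w).1
  | edge i, _, _ => (f.onB_unit i).symm
  | node b ch, w, w' =>
    (f.onB_mul _ _ (isImage_level_of f w w' fun e w' => tot_mapTree (ch e) (w e).2 w')).symm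

theorem isImage_level {b : M.B} {ch : M.Fib b → PreTree M.toPolyEndo} (w : (node b ch).WF)
    (w' : (mapTree f (node b ch)).WF) :
    f.IsImage (M.level b ch w) (N.level (f.onB b) (fun e => mapTree f (ch (f.lift e))) w') :=
  isImage_level_of f w w' fun e w' => tot_mapTree f (ch e) (w e).2 w'

theorem onE_mulE_level {b : M.B} {ch : M.Fib b → PreTree M.toPolyEndo} (w : (node b ch).WF)
    (w' : (mapTree f (node b ch)).WF) (e : M.Fib b) (y : M.Fib (M.tot (ch e) (w e).2).1)
    (e' : N.Fib (f.onB b)) (y' : N.Fib (N.tot (mapTree f (ch (f.lift e'))) (w' e').2).1)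
    (he : e'.1 = f.onE e.1) (hy : y'.1 = f.onE y.1) :
    (N.mulE (N.level (f.onB b) (fun e => mapTree f (ch (f.lift e))) w') ⟨e', y'⟩).1 =
      f.onE (M.mulE (M.level b ch w) ⟨e, y⟩).1 :=
  (f.onE_mulE _ _ (isImage_level f w w') e y e' y' he hy).symm

theorem mapTree_graft : ∀ (T : PreTree M.toPolyEndo) (w : T.WF)
    (g : M.Fib (M.tot T w).1 → PreTree M.toPolyEndo) (w' : (mapTree f T).WF)
    (g' : N.Fib (N.tot (mapTree f T) w').1 → PreTree N.toPolyEndo)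
    (_ : ∀ x x', x'.1 = f.onE x.1 → g' x' = mapTree f (g x)),
    mapTree f (M.graft T w g) = N.graft (mapTree f T) w' g'
  | edge i, _, g, _, g', h => by
    refine (h (M.unitE i) (N.unitE (f.onI i)) ?_).symm
    have := N.unitE_unique (f.onI i) ⟨f.onE (M.unitE i).1, (f.fib (M.unitE i)).2.trans (f.onB_unit i)⟩
    exact (congrArg Subtype.val this).symm
  | node b ch, w, g, w', g', h => by
    change node _ _ = node _ _
    congr 1
    funext e
    refine mapTree_graft (ch (f.lift e)) (w _).2 _ (w' e).2 _ fun y y' hy => ?_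
    exact h _ _ (onE_mulE_level f w w' (f.lift e) y e y' (f.onE_lift e).symm hy)

theorem leafPath_mapTree : ∀ (T : PreTree M.toPolyEndo) (w : T.WF) (w' : (mapTree f T).WF)
    (x : M.Fib (M.tot T w).1) (x' : N.Fib (N.tot (mapTree f T) w').1) (_ : x'.1 = f.onE x.1),
    N.leafPath (mapTree f T) w' x' = (M.leafPath T w x).map f.onE
  | edge i, _, _, _, _, _ => rfl
  | node b ch, w, w', x, x', h => by
    obtain ⟨e', y', rfl⟩ := N.exists_mulE w' x'
    obtain ⟨y, hy⟩ := f.exists_lift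
      (y'.2.trans (tot_mapTree f (ch (f.lift e')) (w (f.lift e')).2 (w' e').2))
    have h1 := onE_mulE_level f w w' (f.lift e') y e' y' (f.onE_lift e').symm hy
    obtain rfl : x = M.mulE (M.level b ch w) ⟨f.lift e', y⟩ :=
      f.onE_inj (b := (M.tot (node b ch) w).1) (h.symm.trans h1)
    refine (N.leafPath_node w' e' y').trans (Eq.trans ?_
      (congrArg (List.map f.onE) (M.leafPath_node w (f.lift e') y)).symm)
    exact congrArg₂ List.cons (f.onE_lift e').symm
      (leafPath_mapTree (ch (f.lift e')) (w _).2 (w' e').2 y y' hy)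

theorem nodeAt_mapTree : ∀ {T : PreTree M.toPolyEndo} {l : List M.E} {b : M.B},
    T.NodeAt l b → (mapTree f T).NodeAt (l.map f.onE) (f.onB b)
  | edge _, _, _, h => h.elim
  | node _ _, [], _, h => congrArg f.onB h
  | node b ch, e :: l, b', ⟨he, h⟩ => by
    refine ⟨(f.fib ⟨e, he⟩).2, ?_⟩
    have := nodeAt_mapTree (T := ch ⟨e, he⟩) h
    rw [← mapTree_child f b ch ⟨e, he⟩] at this
    exact this

theorem exists_of_nodeAt_mapTree : ∀ {T : PreTree M.toPolyEndo} {q : List N.E} {b' : N.B},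
    (mapTree f T).NodeAt q b' → ∃ l b, T.NodeAt l b ∧ q = l.map f.onE ∧ b' = f.onB b
  | edge _, _, _, h => h.elim
  | node b _, [], _, h => ⟨[], b, rfl, rfl, h.symm⟩
  | node b ch, e :: q, b', ⟨he, h⟩ => by
    obtain ⟨l, b1, h1, rfl, rfl⟩ := exists_of_nodeAt_mapTree (T := ch (f.lift ⟨e, he⟩)) h
    exact ⟨(f.lift ⟨e, he⟩).1 :: l, b1, ⟨(f.lift ⟨e, he⟩).2, h1⟩,
      congrArg (· :: l.map f.onE) (f.onE_lift ⟨e, he⟩).symm, rfl⟩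

theorem path_map_inj : ∀ {T : PreTree M.toPolyEndo} {l l' : List M.E} {b b' : M.B},
    T.NodeAt l b → T.NodeAt l' b' → l.map f.onE = l'.map f.onE → l = l'
  | edge _, _, _, _, _, h, _, _ => h.elim
  | node _ _, [], [], _, _, _, _, _ => rfl
  | node _ _, [], _ :: _, _, _, _, _, h => by simp at h
  | node _ _, _ :: _, [], _, _, _, _, h => by simp at h
  | node b ch, e :: l, e' :: l', _, _, ⟨he, h⟩, ⟨he', h'⟩, hh => by
    simp only [List.map_cons, List.cons.injEq] at hh
    obtain rfl : e = e' := congrArg Subtype.val (f.onE_inj (e := ⟨e, he⟩) (e' := ⟨e', he'⟩) hh.1)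
    rw [path_map_inj h h' hh.2]

theorem mapTree_subst : ∀ (T : PreTree M.toPolyEndo) (c : List M.E → M.Tree)
    (hc : M.Matches T c) (c' : List N.E → N.Tree) (hc' : N.Matches (mapTree f T) c')
    (_ : ∀ l b, T.NodeAt l b → (c' (l.map f.onE)).1 = mapTree f (c l).1),
    mapTree f (M.subst T c hc) = N.subst (mapTree f T) c' hc'
  | edge _, _, _, _, _, _ => rfl
  | node b ch, c, hc, c', hc', h => by
    have h0 := h [] b rfl
    change _ = N.graft (c' []).1 (c' []).2 _
    have w' := mapTree_wf f (c []).2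
    have ht : (N.tot _ w').1 = (N.tot _ (c' []).2).1 := N.tot_congr h0.symm _ _
    refine (mapTree_graft f (c []).1 (c []).2 _ w'
      (fun x => N.subst (mapTree f (ch (f.lift ⟨x.1, (x.2.trans ht).trans hc'.root⟩)))
        (fun l => c' (x.1 :: l)) (hc'.child ⟨x.1, _⟩)) ?_).trans
      (N.graft_congr h0.symm _ _ fun x x' hx => ?_)
    · intro x x' hx
      have he : M.p x.1 = b := x.2.trans hc.root
      have hl : f.lift ⟨x'.1, (x'.2.trans ht).trans hc'.root⟩ = ⟨x.1, he⟩ :=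
        f.onE_inj ((f.onE_lift _).trans hx)
      have hcx : N.Matches (mapTree f (ch ⟨x.1, he⟩)) (fun l => c' (x'.1 :: l)) := by
        have := hc'.child ⟨x'.1, (x'.2.trans ht).trans hc'.root⟩
        rw [hl] at this
        exact this
      refine Eq.trans ?_ (mapTree_subst (ch ⟨x.1, he⟩) _ (hc.child ⟨x.1, he⟩) _ hcx ?_).symm
      · exact N.subst_congr (by rw [hl]) _ _ fun _ _ _ => rfl
      · intro l b' hl
        rw [hx]
        exact h (x.1 :: l) b' ⟨he, hl⟩
    · obtain ⟨x, hx1⟩ := x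
      obtain ⟨x', hx2⟩ := x'
      obtain rfl : x = x' := hx
      rfl

theorem expand_mapTree : ∀ (T : PreTree M.toPolyEndo) (c : List M.E → M.Tree)
    (hc : M.Matches T c) (c' : List N.E → N.Tree) (hc' : N.Matches (mapTree f T) c')
    (_ : ∀ l b, T.NodeAt l b → (c' (l.map f.onE)).1 = mapTree f (c l).1)
    {l : List M.E} {b : M.B} (_ : T.NodeAt l b),
    N.expand (mapTree f T) c' hc' (l.map f.onE) = (M.expand T c hc l).map f.onE
  | edge _, _, _, _, _, _, _, _, h => h.elim
  | node _ _, _, _, _, _, _, [], _, _ => rfl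
  | node b ch, c, hc, c', hc', h, e :: l, b1, ⟨he, hl⟩ => by
    have h0 := h [] b rfl
    have w' := mapTree_wf f (c []).2
    have hc2 : N.Matches (node (f.onB b) fun e => mapTree f (ch (f.lift e))) c' := hc'
    have h1 := N.expand_cons hc2 (f.fib ⟨e, he⟩) (l.map f.onE)
    refine h1.trans ?_
    rw [M.expand_cons hc ⟨e, he⟩, List.map_append]
    refine congrArg₂ (· ++ ·) ?_ ?_
    · have ht : (N.tot _ w').1 = (N.tot _ (c' []).2).1 := N.tot_congr h0.symm _ _
      refine Eq.trans ?_ (leafPath_mapTree f (c []).1 (c []).2 w'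
        ⟨e, he.trans hc.root.symm⟩
        ⟨f.onE e, ((f.fib ⟨e, he⟩).2.trans hc2.root.symm).trans ht.symm⟩ rfl)
      exact N.leafPath_congr h0 _ _ rfl
    · have hcx : N.Matches (mapTree f (ch ⟨e, he⟩)) (fun l => c' (f.onE e :: l)) := by
        have := hc2.child (f.fib ⟨e, he⟩)
        rw [f.lift_fib] at this
        exact this
      refine Eq.trans ?_ (expand_mapTree (ch ⟨e, he⟩) (fun l => c (e :: l)) (hc.child ⟨e, he⟩)
        (fun l => c' (f.onE e :: l)) hcx (fun l b' hl => h (e :: l) b' ⟨he, hl⟩) hl)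
      exact N.expand_congr (mapTree_child f b ch ⟨e, he⟩) _ _ (fun _ _ _ => rfl) _

/-- The induced map `tr(P') → tr(P)`. -/
noncomputable def mapT (T : M.Tree) : N.Tree := ⟨mapTree f T.1, mapTree_wf f T.2⟩

/-- The induced map `tr•(P') → tr•(P)`. -/
noncomputable def mapMarked (x : M.MarkedTree) : N.MarkedTree where
  tree := mapT f x.tree
  path := x.path.map f.onE
  op := f.onB x.op
  isNode := nodeAt_mapTree f x.isNode

/-- The effect of the Baez–Dolan construction on underlying polynomial endofunctors. -/
noncomputable def bdPolyHom : PolyHom M.bdEndo N.bdEndo where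
  onI := f.onB
  onB := mapT f
  onE := mapMarked f
  s_onE _ := rfl
  p_onE _ := rfl
  t_onB T := tot_mapTree f T.1 T.2 _
  cartesian T := by
    constructor
    · intro x y h
      have h1 : x.1.path.map f.onE = y.1.path.map f.onE := congrArg (fun z => z.1.path) h
      exact Subtype.ext (MarkedTree.eq_of (x.2.trans y.2.symm)
        (path_map_inj f (M.isNode_of_fib x) (M.isNode_of_fib y) h1))
    · intro y
      obtain ⟨l, b, h, h1, h2⟩ := exists_of_nodeAt_mapTree f (N.isNode_of_fib y)
      exact ⟨M.mark T h, Subtype.ext (MarkedTree.eq_of y.2.symm h1.symm)⟩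

theorem filling_image {x : M.bdEndo.TwoLevel} {y : N.bdEndo.TwoLevel}
    (h : (bdPolyHom f).IsImage x y) (l : List M.E) (b : M.B) (hl : x.op.1.NodeAt l b) :
    (N.filling y (l.map f.onE)).1 = mapTree f (M.filling x l).1 := by
  have hop : y.op.1 = mapTree f x.op.1 := congrArg Subtype.val h.op
  have hl' : y.op.1.NodeAt (l.map f.onE) (f.onB b) := by
    rw [hop]
    exact nodeAt_mapTree f hl
  rw [M.filling_eq x hl, N.filling_eq y hl']
  exact congrArg Subtype.val (h.top (M.mark x.op hl) (N.mark y.op hl')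
    (MarkedTree.eq_of h.op rfl))

theorem bdMul_image {x : M.bdEndo.TwoLevel} {y : N.bdEndo.TwoLevel}
    (h : (bdPolyHom f).IsImage x y) : mapT f (M.bdMul x) = N.bdMul y := by
  have hop : y.op.1 = mapTree f x.op.1 := congrArg Subtype.val h.op
  have hm : N.Matches (mapTree f x.op.1) (N.filling y) :=
    Matches.congr N hop (fun _ _ _ => rfl) (N.filling_matches y)
  refine Subtype.ext ((mapTree_subst f x.op.1 _ (M.filling_matches x) _ hm
    (filling_image f h)).trans ?_)
  exact N.subst_congr hop.symm _ _ fun _ _ _ => rfl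

/-- The effect of the Baez–Dolan construction on morphisms. -/
noncomputable def bdMap : Hom M.bd N.bd where
  toPolyHom := bdPolyHom f
  onB_unit b := by
    refine Subtype.ext ?_
    change node _ _ = node _ _
    congr 1
    funext e
    exact congrArg edge ((f.s_onE _).symm.trans (congrArg N.s (f.onE_lift e)))
  onB_mul x y h := bdMul_image f h
  onE_mulE x y h e k e' k' he hk := by
    refine MarkedTree.eq_of (bdMul_image f h) ?_
    have hop : y.op.1 = mapTree f x.op.1 := congrArg Subtype.val h.op
    have hm : N.Matches (mapTree f x.op.1) (N.filling y) :=
      Matches.congr N hop (fun _ _ _ => rfl) (N.filling_matches y)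
    refine (List.map_append ..).trans (congrArg₂ (· ++ ·) ?_ (congrArg MarkedTree.path hk).symm)
    refine (expand_mapTree f x.op.1 _ (M.filling_matches x) _ hm (filling_image f h)
      (M.isNode_of_fib e)).symm.trans ?_
    refine (congrArg _ (congrArg MarkedTree.path he).symm).trans ?_
    exact N.expand_congr hop.symm _ _ (fun _ _ _ => rfl) _

theorem lift_id {b : M.B} (e : M.Fib b) : (Hom.id M).lift (b := b) e = e :=
  (Hom.id M).lift_fib (b := b) e

theorem mapTree_id : ∀ T : PreTree M.toPolyEndo, mapTree (Hom.id M) T = T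
  | edge i => rfl
  | node b ch => by
    change node _ _ = node _ _
    congr 1
    funext e
    exact (mapTree_id _).trans (congrArg ch (lift_id e))

theorem mapTree_comp {K : PolyMonad.{u}} (g : Hom N K) : ∀ T : PreTree M.toPolyEndo,
    mapTree (f.comp g) T = mapTree g (mapTree f T)
  | edge i => rfl
  | node b ch => by
    change node _ _ = node _ _
    congr 1
    funext e
    refine (mapTree_comp g _).trans (congrArg (fun z => mapTree g (mapTree f (ch z))) ?_)
    refine (f.comp g).onE_inj (((f.comp g).onE_lift e).trans ?_)
    change e.1 = g.onE (f.onE _)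
    rw [f.onE_lift]
    exact (g.onE_lift e).symm

/-- The Baez–Dolan functor on polynomial monads. -/
noncomputable def BD : CategoryTheory.Functor PolyMonad.{u} PolyMonad.{u} where
  obj := bd
  map := bdMap
  map_id M := Hom.ext_of (fun _ => rfl) (fun T => Subtype.ext (mapTree_id T.1))
    (fun x => MarkedTree.eq_of (Subtype.ext (mapTree_id x.tree.1)) (List.map_id _))
  map_comp f g := Hom.ext_of (fun _ => rfl) (fun T => Subtype.ext (mapTree_comp f g T.1))
    (fun x => MarkedTree.eq_of (Subtype.ext (mapTree_comp f g x.tree.1)) (List.map_map (g := (Hom.toPolyHom g).onE) (f := (Hom.toPolyHom f).onE) (l := x.path)).symm)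

end PolyMonad

open CategoryTheory

namespace PolyMonad

/-- The set of types. -/
def typFunctor : PolyMonad.{u} ⥤ Type u where
  obj M := M.I
  map f := ↾f.onI

/-- The set of operations. -/
def opFunctor : PolyMonad.{u} ⥤ Type u where
  obj M := M.B
  map f := ↾f.onB

/-- The set of partial operations. -/
def partFunctor : PolyMonad.{u} ⥤ Type u where
  obj M := M.E
  map f := ↾f.onE

theorem exists_lift_of_finite (G : ℕ ⥤ Type u) {A : Type u} [Finite A] (x : A → G.ColimitType)
    (n : ℕ) : ∃ m, n ≤ m ∧ ∃ y : A → G.obj m, ∀ a, G.ιColimitType m (y a) = x a := by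
  choose k y hy using fun a => G.ιColimitType_jointly_surjective (x a)
  obtain ⟨K, hK⟩ := (Set.finite_range k).bddAbove
  refine ⟨n + K, Nat.le_add_right _ _, fun a => G.map
    (homOfLE ((hK ⟨a, rfl⟩).trans (Nat.le_add_left _ _))) (y a), fun a => ?_⟩
  rw [G.ιColimitType_map, hy]

theorem exists_eq_of_finite (G : ℕ ⥤ Type u) {A : Type u} [Finite A] {m : ℕ}
    (y y' : A → G.obj m) (h : ∀ a, G.ιColimitType m (y a) = G.ιColimitType m (y' a)) :
    ∃ k, ∃ hk : m ≤ k, ∀ a, G.map (homOfLE hk) (y a) = G.map (homOfLE hk) (y' a) := by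
  choose k f hf using fun a => (G.ιColimitType_eq_iff_of_isFiltered' _ _).1 (h a)
  obtain ⟨K, hK⟩ := (Set.finite_range k).bddAbove
  refine ⟨m + K, Nat.le_add_right _ _, fun a => ?_⟩
  have e : homOfLE (Nat.le_add_right m K) =
    f a ≫ homOfLE ((hK ⟨a, rfl⟩).trans (Nat.le_add_left K m)) := Subsingleton.elim _ _
  rw [e, G.map_comp]
  exact congrArg (fun z => G.map (homOfLE ((hK ⟨a, rfl⟩).trans (Nat.le_add_left K m))) z) (hf a)

section SeqColimit

variable (F : ℕ ⥤ PolyMonad.{u})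

/-- The transition map of the chain from stage `n` to stage `m`. -/
def trans {n m : ℕ} (h : n ≤ m) : Hom (F.obj n) (F.obj m) := F.map (homOfLE h)

theorem trans_comp {n m k : ℕ} (h : n ≤ m) (h' : m ≤ k) :
    trans F (h.trans h') = (trans F h).comp (trans F h') :=
  (F.map_comp (homOfLE h) (homOfLE h'))

/-- The colimit of the sets of types along the chain. -/
abbrev ColimI : Type u := (F ⋙ typFunctor).ColimitType
/-- The colimit of the sets of operations along the chain. -/
abbrev ColimB : Type u := (F ⋙ opFunctor).ColimitType
/-- The colimit of the sets of partial operations along the chain. -/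
abbrev ColimE : Type u := (F ⋙ partFunctor).ColimitType

abbrev inI (n : ℕ) (i : (F.obj n).I) : ColimI F := (F ⋙ typFunctor).ιColimitType n i
abbrev inB (n : ℕ) (b : (F.obj n).B) : ColimB F := (F ⋙ opFunctor).ιColimitType n b
abbrev inE (n : ℕ) (e : (F.obj n).E) : ColimE F := (F ⋙ partFunctor).ιColimitType n e

theorem inI_trans {n m : ℕ} (h : n ≤ m) (i) : inI F m ((trans F h).onI i) = inI F n i :=
  (F ⋙ typFunctor).ιColimitType_map (homOfLE h) i
theorem inB_trans {n m : ℕ} (h : n ≤ m) (b) : inB F m ((trans F h).onB b) = inB F n b :=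
  (F ⋙ opFunctor).ιColimitType_map (homOfLE h) b
theorem inE_trans {n m : ℕ} (h : n ≤ m) (e) : inE F m ((trans F h).onE e) = inE F n e :=
  (F ⋙ partFunctor).ιColimitType_map (homOfLE h) e

theorem inB_eq {n m : ℕ} {b b'} (h : inB F n b = inB F m b') :
    ∃ k, ∃ (hn : n ≤ k) (hm : m ≤ k), (trans F hn).onB b = (trans F hm).onB b' := by
  obtain ⟨k, f, f', hk⟩ := ((F ⋙ opFunctor).ιColimitType_eq_iff_of_isFiltered b b').1 h
  exact ⟨k, leOfHom f, leOfHom f', hk⟩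

theorem inE_eq {n : ℕ} {e e'} (h : inE F n e = inE F n e') :
    ∃ k, ∃ (hn : n ≤ k), (trans F hn).onE e = (trans F hn).onE e' := by
  obtain ⟨k, f, hk⟩ := ((F ⋙ partFunctor).ιColimitType_eq_iff_of_isFiltered' e e').1 h
  exact ⟨k, leOfHom f, hk⟩

theorem exists_inI (x : ColimI F) : ∃ n, ∃ i : (F.obj n).I, inI F n i = x :=
  (F ⋙ typFunctor).ιColimitType_jointly_surjective x
theorem exists_inB (x : ColimB F) : ∃ n, ∃ b : (F.obj n).B, inB F n b = x :=
  (F ⋙ opFunctor).ιColimitType_jointly_surjective x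
theorem exists_inE (x : ColimE F) : ∃ n, ∃ e : (F.obj n).E, inE F n e = x :=
  (F ⋙ partFunctor).ιColimitType_jointly_surjective x

theorem exists_lift_B {A : Type u} [Finite A] (x : A → ColimB F) (n : ℕ) :
    ∃ m, n ≤ m ∧ ∃ y : A → (F.obj m).B, ∀ a, inB F m (y a) = x a :=
  exists_lift_of_finite (F ⋙ opFunctor) x n
theorem exists_eq_B {A : Type u} [Finite A] {m : ℕ} (y y' : A → (F.obj m).B)
    (h : ∀ a, inB F m (y a) = inB F m (y' a)) :
    ∃ k, ∃ hk : m ≤ k, ∀ a, (trans F hk).onB (y a) = (trans F hk).onB (y' a) :=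
  exists_eq_of_finite (F ⋙ opFunctor) y y' h
theorem exists_eq_I {A : Type u} [Finite A] {m : ℕ} (y y' : A → (F.obj m).I)
    (h : ∀ a, inI F m (y a) = inI F m (y' a)) :
    ∃ k, ∃ hk : m ≤ k, ∀ a, (trans F hk).onI (y a) = (trans F hk).onI (y' a) :=
  exists_eq_of_finite (F ⋙ typFunctor) y y' h

def colimS : ColimE F → ColimI F :=
  Quot.lift (fun x => inI F x.1 ((F.obj x.1).s x.2)) (by
    rintro ⟨n, e⟩ ⟨m, e'⟩ ⟨f, hf⟩
    have h : (trans F (leOfHom f)).onE e = e' := hf.symm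
    exact (inI_trans F (leOfHom f) _).symm.trans (congrArg (inI F m)
      ((((trans F (leOfHom f)).s_onE e).symm).trans (congrArg ((F.obj m).s) h))))

def colimP : ColimE F → ColimB F :=
  Quot.lift (fun x => inB F x.1 ((F.obj x.1).p x.2)) (by
    rintro ⟨n, e⟩ ⟨m, e'⟩ ⟨f, hf⟩
    have h : (trans F (leOfHom f)).onE e = e' := hf.symm
    exact (inB_trans F (leOfHom f) _).symm.trans (congrArg (inB F m)
      ((((trans F (leOfHom f)).p_onE e).symm).trans (congrArg ((F.obj m).p) h))))

def colimT : ColimB F → ColimI F :=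
  Quot.lift (fun x => inI F x.1 ((F.obj x.1).t x.2)) (by
    rintro ⟨n, e⟩ ⟨m, e'⟩ ⟨f, hf⟩
    have h : (trans F (leOfHom f)).onB e = e' := hf.symm
    exact (inI_trans F (leOfHom f) _).symm.trans (congrArg (inI F m)
      ((((trans F (leOfHom f)).t_onB e).symm).trans (congrArg ((F.obj m).t) h))))

theorem inE_bijective (n : ℕ) (b : (F.obj n).B) : Function.Bijective
    (fun e : (F.obj n).Fib b =>
      (⟨inE F n e.1, congrArg (inB F n) e.2⟩ : {e : ColimE F // colimP F e = inB F n b})) := by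
  constructor
  · intro e e' h
    obtain ⟨k, hk, h⟩ := inE_eq F (congrArg Subtype.val h)
    exact (trans F hk).onE_inj h
  · rintro ⟨e, he⟩
    obtain ⟨m, e, rfl⟩ := exists_inE F e
    obtain ⟨k, hm, hn, h⟩ := inB_eq F (show inB F m ((F.obj m).p e) = inB F n b from he)
    obtain ⟨e', he'⟩ := (trans F hn).exists_lift (((trans F hm).p_onE e).trans h)
    refine ⟨e', Subtype.ext ?_⟩
    change inE F n e'.1 = inE F m e
    exact (inE_trans F hn e'.1).symm.trans ((congrArg (inE F k) he'.symm).trans (inE_trans F hm e))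

/-- The diagram of sets obtained as the levelwise colimit of the chain. -/
def colimEndo : PolyEndo.{u} where
  I := ColimI F
  B := ColimB F
  E := ColimE F
  s := colimS F
  p := colimP F
  t := colimT F
  finite_fib b := by
    obtain ⟨n, b, rfl⟩ := exists_inB F b
    have := (F.obj n).finite_fib b
    exact Finite.of_surjective _ (inE_bijective F n b).2

/-- The inclusion of stage `n`. -/
def colimPolyHom (n : ℕ) : PolyHom (F.obj n).toPolyEndo (colimEndo F) where
  onI := inI F n
  onB := inB F n
  onE := inE F n
  s_onE _ := rfl
  p_onE _ := rfl
  t_onB _ := rfl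
  cartesian b := inE_bijective F n b

theorem isImage_trans {n m : ℕ} (h : n ≤ m) {x : (F.obj n).TwoLevel} {y : (F.obj m).TwoLevel}
    {z : (colimEndo F).TwoLevel} (hxy : (trans F h).IsImage x y)
    (hz : (colimPolyHom F n).IsImage x z) : (colimPolyHom F m).IsImage y z where
  op := by
    rw [hz.op, hxy.op]
    exact (inB_trans F h _).symm
  top e e' he := by
    obtain ⟨e0, he0⟩ := (trans F h).exists_lift (e.2.trans hxy.op)
    rw [hxy.top e0 e he0]
    refine (hz.top e0 e' (he.trans ?_)).trans (inB_trans F h _).symm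
    rw [he0]
    exact inE_trans F h _

theorem exists_isImage (z : (colimEndo F).TwoLevel) :
    ∃ n, ∃ x : (F.obj n).TwoLevel, (colimPolyHom F n).IsImage x z := by
  obtain ⟨b, c, hc⟩ := z
  obtain ⟨n, b, rfl⟩ := exists_inB F b
  have := (F.obj n).finite_fib b
  obtain ⟨m, hm, y, hy⟩ := exists_lift_B F
    (fun e : (F.obj n).Fib b => c ((colimPolyHom F n).fib e)) n
  obtain ⟨k, hk, hk'⟩ := exists_eq_I F (A := (F.obj n).Fib b)
    (fun e => (F.obj m).t (y e)) (fun e => (trans F hm).onI ((F.obj n).s e.1)) (by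
      intro e
      refine Eq.trans ?_ (inI_trans F hm _).symm
      refine Eq.trans ?_ (hc ((colimPolyHom F n).fib e))
      exact congrArg (colimT F) (hy e))
  refine ⟨k, ⟨(trans F (hm.trans hk)).onB b, fun e =>
    (trans F hk).onB (y ((trans F (hm.trans hk)).lift e)), fun e => ?_⟩, (inB_trans F _ _).symm,
    fun e e' he => ?_⟩
  · refine ((trans F hk).t_onB _).trans ((hk' _).trans ?_)
    obtain ⟨e0, rfl⟩ : ∃ e0, e = (trans F (hm.trans hk)).fib e0 :=
      ⟨_, ((trans F (hm.trans hk)).fib_lift e).symm⟩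
    rw [PolyHom.lift_fib]
    refine Eq.trans ?_ ((trans F (hm.trans hk)).s_onE _).symm
    rw [trans_comp F hm hk]
    rfl
  · refine Eq.trans ?_ (inB_trans F hk _).symm
    refine Eq.trans (congrArg c (Subtype.ext ?_)) (hy _).symm
    rw [he]
    refine (congrArg (inE F k) ((trans F (hm.trans hk)).onE_lift e).symm).trans ?_
    exact inE_trans F _ _

theorem image_eq {n m : ℕ} {x : (F.obj n).TwoLevel} {y : (F.obj m).TwoLevel}
    {z : (colimEndo F).TwoLevel} (hx : (colimPolyHom F n).IsImage x z)
    (hy : (colimPolyHom F m).IsImage y z) :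
    ∃ k, ∃ (hn : n ≤ k) (hm : m ≤ k), (trans F hn).image x = (trans F hm).image y := by
  obtain ⟨k, hn, hm, hop⟩ := inB_eq F (hx.op.symm.trans hy.op)
  have hx' := isImage_trans F hn ((trans F hn).isImage_image x) hx
  have hy' := isImage_trans F hm ((trans F hm).isImage_image y) hy
  have := (F.obj k).finite_fib ((trans F hn).image x).op
  obtain ⟨l, hl, hl'⟩ := exists_eq_B F
    (A := (F.obj k).Fib ((trans F hn).image x).op)
    ((trans F hn).image x).top (fun e => ((trans F hm).image y).top ⟨e.1, e.2.trans hop⟩) (by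
      intro e
      have hp : colimP F (inE F k e.1) = z.op := (congrArg (inB F k) e.2).trans hx'.op.symm
      exact (hx'.top e ⟨inE F k e.1, hp⟩ rfl).symm.trans
        (hy'.top ⟨e.1, e.2.trans hop⟩ ⟨inE F k e.1, hp⟩ rfl))
  refine ⟨l, hn.trans hl, hm.trans hl, PolyEndo.TwoLevel.ext_fib ?_ fun e he he' => ?_⟩
  · change (trans F (hn.trans hl)).onB x.op = (trans F (hm.trans hl)).onB y.op
    rw [trans_comp F hn hl, trans_comp F hm hl]
    exact congrArg _ hop
  · obtain ⟨e0, h0⟩ := (trans F (hn.trans hl)).exists_lift he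
    obtain ⟨e1, h1⟩ := (trans F (hm.trans hl)).exists_lift he'
    refine (((trans F (hn.trans hl)).isImage_image x).top e0 ⟨e, he⟩ h0).trans (Eq.trans ?_
      (((trans F (hm.trans hl)).isImage_image y).top e1 ⟨e, he'⟩ h1).symm)
    have h2 := hl' ((trans F hn).fib e0)
    rw [((trans F hn).isImage_image x).top e0 ((trans F hn).fib e0) rfl] at h2
    have h3 : (trans F hn).onE e0.1 = (trans F hm).onE e1.1 := by
      have h4 : (trans F hl).onE ((trans F hn).onE e0.1) =
          (trans F hl).onE ((trans F hm).onE e1.1) := by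
        have h5 := h0.symm.trans h1
        rw [trans_comp F hn hl, trans_comp F hm hl] at h5
        exact h5
      exact congrArg Subtype.val ((trans F hl).onE_inj
        (e := ⟨_, ((trans F hn).fib e0).2.trans hop⟩) (e' := (trans F hm).fib e1) h4)
    rw [((trans F hm).isImage_image y).top e1 ⟨((trans F hn).fib e0).1, _⟩ h3] at h2
    rw [trans_comp F hn hl, trans_comp F hm hl]
    exact h2

/-- The multiplication: represent a two-level tree at some stage and multiply there. -/
noncomputable def colimMul (z : (colimEndo F).TwoLevel) : ColimB F :=
  inB F _ ((F.obj _).mul (exists_isImage F z).choose_spec.choose)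

theorem colimMul_eq {n : ℕ} {x : (F.obj n).TwoLevel} {z : (colimEndo F).TwoLevel}
    (h : (colimPolyHom F n).IsImage x z) : colimMul F z = inB F n ((F.obj n).mul x) := by
  obtain ⟨k, hm, hn, hk⟩ := image_eq F (exists_isImage F z).choose_spec.choose_spec h
  have h1 := (trans F hm).onB_mul _ _ ((trans F hm).isImage_image
    (exists_isImage F z).choose_spec.choose)
  have h2 := (trans F hn).onB_mul _ _ ((trans F hn).isImage_image x)
  refine (inB_trans F hm _).symm.trans (Eq.trans (congrArg (inB F k) ?_) (inB_trans F hn _))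
  rw [h1, h2, hk]

/-- The input, at stage `n`, represented by `e`. -/
noncomputable def stageE {n : ℕ} {x : (F.obj n).TwoLevel} {z : (colimEndo F).TwoLevel}
    (h : (colimPolyHom F n).IsImage x z) (e : (colimEndo F).Fib z.op) : (F.obj n).Fib x.op :=
  (colimPolyHom F n).lift ⟨e.1, e.2.trans h.op⟩

theorem inE_stageE {n : ℕ} {x : (F.obj n).TwoLevel} {z : (colimEndo F).TwoLevel}
    (h : (colimPolyHom F n).IsImage x z) (e : (colimEndo F).Fib z.op) :
    e.1 = inE F n (stageE F h e).1 :=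
  ((colimPolyHom F n).onE_lift ⟨e.1, e.2.trans h.op⟩).symm

/-- The input of an upper operation, at stage `n`, represented by `f`. -/
noncomputable def stageF {n : ℕ} {x : (F.obj n).TwoLevel} {z : (colimEndo F).TwoLevel}
    (h : (colimPolyHom F n).IsImage x z) (e : (colimEndo F).Fib z.op)
    (f : (colimEndo F).Fib (z.top e)) : (F.obj n).Fib (x.top (stageE F h e)) :=
  (colimPolyHom F n).lift ⟨f.1, f.2.trans (h.top (stageE F h e) e (inE_stageE F h e))⟩

theorem inE_stageF {n : ℕ} {x : (F.obj n).TwoLevel} {z : (colimEndo F).TwoLevel}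
    (h : (colimPolyHom F n).IsImage x z) (e : (colimEndo F).Fib z.op)
    (f : (colimEndo F).Fib (z.top e)) : f.1 = inE F n (stageF F h e f).1 :=
  ((colimPolyHom F n).onE_lift
    ⟨f.1, f.2.trans (h.top (stageE F h e) e (inE_stageE F h e))⟩).symm

/-- The multiplication on inputs. -/
noncomputable def colimMulE (z : (colimEndo F).TwoLevel)
    (q : Σ e : (colimEndo F).Fib z.op, (colimEndo F).Fib (z.top e)) :
    (colimEndo F).Fib (colimMul F z) :=
  (colimPolyHom F _).fib ((F.obj _).mulE (exists_isImage F z).choose_spec.choose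
    ⟨stageE F (exists_isImage F z).choose_spec.choose_spec q.1,
      stageF F (exists_isImage F z).choose_spec.choose_spec q.1 q.2⟩)

theorem inE_inj {n m k : ℕ} (hn : n ≤ k) (hm : m ≤ k) {e : (F.obj n).E} {e' : (F.obj m).E}
    (h : inE F n e = inE F m e')
    (hp : (trans F hn).onB ((F.obj n).p e) = (trans F hm).onB ((F.obj m).p e')) :
    (trans F hn).onE e = (trans F hm).onE e' := by
  have h' : inE F k ((trans F hn).onE e) = inE F k ((trans F hm).onE e') := by
    rw [inE_trans, inE_trans, h]
  exact congrArg Subtype.val ((colimPolyHom F k).onE_inj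
    (e := ⟨_, ((trans F hn).p_onE e).trans hp⟩) (e' := ⟨_, (trans F hm).p_onE e'⟩) h')

theorem colimMulE_eq {n : ℕ} {x : (F.obj n).TwoLevel} {z : (colimEndo F).TwoLevel}
    (h : (colimPolyHom F n).IsImage x z) (e : (F.obj n).Fib x.op) (f : (F.obj n).Fib (x.top e))
    (e' : (colimEndo F).Fib z.op) (f' : (colimEndo F).Fib (z.top e'))
    (he : e'.1 = inE F n e.1) (hf : f'.1 = inE F n f.1) :
    (colimMulE F z ⟨e', f'⟩).1 = inE F n ((F.obj n).mulE x ⟨e, f⟩).1 := by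
  generalize hX : exists_isImage F z = X
  obtain ⟨k, hm, hn, hk⟩ := image_eq F X.choose_spec.choose_spec h
  have hx1 := (trans F hm).isImage_image X.choose_spec.choose
  have hx2 := (trans F hn).isImage_image x
  have h1 := (trans F hm).onE_mulE _ _ hx1 (stageE F X.choose_spec.choose_spec e')
    (stageF F X.choose_spec.choose_spec e' f') ((trans F hm).fib _)
    ⟨_, ((trans F hm).fib (stageF F X.choose_spec.choose_spec e' f')).2.trans
      (hx1.top _ _ rfl).symm⟩ rfl rfl
  have h2 := (trans F hn).onE_mulE _ _ hx2 e f ((trans F hn).fib _)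
    ⟨_, ((trans F hn).fib f).2.trans (hx2.top _ _ rfl).symm⟩ rfl rfl
  have hop : (trans F hm).onB X.choose_spec.choose.op = (trans F hn).onB x.op :=
    congrArg PolyEndo.TwoLevel.op hk
  have hE : (trans F hm).onE (stageE F X.choose_spec.choose_spec e').1 = (trans F hn).onE e.1 :=
    inE_inj F hm hn ((inE_stageE F X.choose_spec.choose_spec e').symm.trans he)
      (by rw [(stageE F X.choose_spec.choose_spec e').2, e.2, hop])
  have htop : (trans F hm).onB (X.choose_spec.choose.top (stageE F X.choose_spec.choose_spec e')) =
      (trans F hn).onB (x.top e) := by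
    rw [← hx1.top _ ((trans F hm).fib _) rfl, ← hx2.top _ ((trans F hn).fib _) rfl]
    have : ∀ (a b : (F.obj k).TwoLevel) (_ : a = b) (u : (F.obj k).Fib a.op)
      (v : (F.obj k).Fib b.op), u.1 = v.1 → a.top u = b.top v := by
      rintro a _ rfl u v huv
      rw [Subtype.ext huv]
    exact this _ _ hk _ _ hE
  have hF : (trans F hm).onE (stageF F X.choose_spec.choose_spec e' f').1 =
      (trans F hn).onE f.1 :=
    inE_inj F hm hn ((inE_stageF F X.choose_spec.choose_spec e' f').symm.trans hf)
      (by rw [(stageF F X.choose_spec.choose_spec e' f').2, f.2, htop])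
  refine Eq.trans ?_ (inE_trans F hn _)
  rw [h2]
  refine (inE_trans F hm _).symm.trans (congrArg (inE F k) (h1.trans ?_))
  exact (F.obj k).mulE_congr hk hE hF

theorem colimMulE_bijective (z : (colimEndo F).TwoLevel) :
    Function.Bijective (colimMulE F z) := by
  obtain ⟨n, x, hx⟩ := exists_isImage F z
  constructor
  · rintro ⟨e, f⟩ ⟨e', f'⟩ h
    have h1 := congrArg Subtype.val h
    rw [colimMulE_eq F hx _ _ e f (inE_stageE F hx e) (inE_stageF F hx e f),
      colimMulE_eq F hx _ _ e' f' (inE_stageE F hx e') (inE_stageF F hx e' f')] at h1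
    have h2 := ((F.obj n).mulE x).injective ((colimPolyHom F n).onE_inj h1)
    obtain rfl : e = e' := Subtype.ext (by
      rw [inE_stageE F hx e, inE_stageE F hx e']
      exact congrArg (fun q => inE F n q.1.1) h2)
    obtain rfl : f = f' := Subtype.ext (by
      rw [inE_stageF F hx e f, inE_stageF F hx e f']
      exact congrArg (fun q => inE F n q.2.1) h2)
    rfl
  · intro g
    have hm := colimMul_eq F hx
    obtain ⟨g', hg'⟩ := (colimPolyHom F n).exists_lift (g.2.trans hm)
    obtain ⟨⟨e, f⟩, rfl⟩ := ((F.obj n).mulE x).surjective g'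
    have he : (colimEndo F).p (inE F n e.1) = z.op := (congrArg (inB F n) e.2).trans hx.op.symm
    have hf : (colimEndo F).p (inE F n f.1) = z.top ⟨_, he⟩ :=
      (congrArg (inB F n) f.2).trans (hx.top e ⟨_, he⟩ rfl).symm
    exact ⟨⟨⟨_, he⟩, ⟨_, hf⟩⟩, Subtype.ext
      ((colimMulE_eq F hx e f ⟨_, he⟩ ⟨_, hf⟩ rfl rfl).trans hg'.symm)⟩

def colimUnit : ColimI F → ColimB F :=
  Quot.lift (fun x => inB F x.1 ((F.obj x.1).unit x.2)) (by
    rintro ⟨n, e⟩ ⟨m, e'⟩ ⟨f, hf⟩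
    have h : (trans F (leOfHom f)).onI e = e' := hf.symm
    exact (inB_trans F (leOfHom f) _).symm.trans (congrArg (inB F m)
      (((trans F (leOfHom f)).onB_unit e).trans (congrArg ((F.obj m).unit) h))))

theorem onE_unitE {M N : PolyMonad.{u}} (f : Hom M N) (i : M.I) :
    f.onE (M.unitE i).1 = (N.unitE (f.onI i)).1 :=
  congrArg Subtype.val (N.unitE_unique (f.onI i)
    ⟨f.onE (M.unitE i).1, (f.fib (M.unitE i)).2.trans (f.onB_unit i)⟩)

def colimUnitE' : ColimI F → ColimE F :=
  Quot.lift (fun x => inE F x.1 ((F.obj x.1).unitE x.2).1) (by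
    rintro ⟨n, e⟩ ⟨m, e'⟩ ⟨f, hf⟩
    have h : (trans F (leOfHom f)).onI e = e' := hf.symm
    exact (inE_trans F (leOfHom f) _).symm.trans (congrArg (inE F m)
      ((onE_unitE (trans F (leOfHom f)) e).trans (congrArg (fun z => ((F.obj m).unitE z).1) h))))

theorem colimUnitE_mem (i : ColimI F) : colimP F (colimUnitE' F i) = colimUnit F i := by
  obtain ⟨n, i, rfl⟩ := exists_inI F i
  exact congrArg (inB F n) ((F.obj n).unitE i).2

theorem colimMul_inB_t (z : (colimEndo F).TwoLevel) : colimT F (colimMul F z) = colimT F z.op := by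
  obtain ⟨n, x, hx⟩ := exists_isImage F z
  rw [colimMul_eq F hx, hx.op]
  exact congrArg (inI F n) ((F.obj n).t_mul x)

theorem unit_mul_of (M : PolyMonad.{u}) (x : M.TwoLevel) (i : M.I) (h : x.op = M.unit i) :
    M.mul x = x.top ⟨(M.unitE i).1, (M.unitE i).2.trans h.symm⟩ := by
  obtain ⟨b, c, hc⟩ := x
  obtain rfl : b = M.unit i := h
  exact M.unit_mul i c hc

theorem unit_mulE_of (M : PolyMonad.{u}) (x : M.TwoLevel) (i : M.I) (h : x.op = M.unit i) (f) :
    (M.mulE x ⟨⟨(M.unitE i).1, (M.unitE i).2.trans h.symm⟩, f⟩).1 = f.1 := by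
  obtain ⟨b, c, hc⟩ := x
  obtain rfl : b = M.unit i := h
  exact M.unit_mulE i c hc f

theorem exists_unit_stage (z : (colimEndo F).TwoLevel) (i : ColimI F)
    (h : z.op = colimUnit F i) : ∃ n, ∃ x : (F.obj n).TwoLevel, ∃ j,
      (colimPolyHom F n).IsImage x z ∧ x.op = (F.obj n).unit j ∧ i = inI F n j := by
  obtain ⟨n, x, hx⟩ := exists_isImage F z
  obtain ⟨m, i, rfl⟩ := exists_inI F i
  obtain ⟨k, hn, hm, hk⟩ := inB_eq F (hx.op.symm.trans h)
  exact ⟨k, (trans F hn).image x, (trans F hm).onI i,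
    isImage_trans F hn ((trans F hn).isImage_image x) hx,
    hk.trans ((trans F hm).onB_unit i), (inI_trans F hm i).symm⟩

theorem exists_assoc_stage (z : (colimEndo F).TwoLevel)
    (d : (colimEndo F).Fib (colimMul F z) → ColimB F) (hd : ∀ g, colimT F (d g) = colimS F g.1) :
    ∃ n, ∃ (x : (F.obj n).TwoLevel) (c : (F.obj n).Fib ((F.obj n).mul x) → (F.obj n).B)
      (hc : ∀ g, (F.obj n).t (c g) = (F.obj n).s g.1), (colimPolyHom F n).IsImage x z ∧
        (colimPolyHom F n).IsImage ⟨(F.obj n).mul x, c, hc⟩ ⟨colimMul F z, d, hd⟩ := by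
  obtain ⟨n, x, hx⟩ := exists_isImage F z
  obtain ⟨m, y, hy⟩ := exists_isImage F ⟨colimMul F z, d, hd⟩
  obtain ⟨k, hn, hm, hk⟩ := inB_eq F ((colimMul_eq F hx).symm.trans hy.op)
  rw [(trans F hn).onB_mul _ _ ((trans F hn).isImage_image x)] at hk
  have hx' := isImage_trans F hn ((trans F hn).isImage_image x) hx
  have hy' := isImage_trans F hm ((trans F hm).isImage_image y) hy
  have hk' : (F.obj k).mul ((trans F hn).image x) = ((trans F hm).image y).op := hk
  generalize (trans F hn).image x = x' at *
  generalize (trans F hm).image y = y' at *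
  obtain ⟨b, c, hc⟩ := y'
  obtain rfl : _ = b := hk'
  exact ⟨k, x', c, hc, hx', hy'⟩

theorem isImage_inner {z : (colimEndo F).TwoLevel}
    {d : (colimEndo F).Fib (colimMul F z) → ColimB F} {hd : ∀ g, colimT F (d g) = colimS F g.1}
    {n : ℕ} {x : (F.obj n).TwoLevel} {c : (F.obj n).Fib ((F.obj n).mul x) → (F.obj n).B}
    {hc : ∀ g, (F.obj n).t (c g) = (F.obj n).s g.1} (hx : (colimPolyHom F n).IsImage x z)
    (hy : (colimPolyHom F n).IsImage ⟨(F.obj n).mul x, c, hc⟩ ⟨colimMul F z, d, hd⟩)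
    (e : (F.obj n).Fib x.op) (e' : (colimEndo F).Fib z.op) (he : e'.1 = inE F n e.1) (h1 h2) :
    (colimPolyHom F n).IsImage
      ⟨x.top e, fun f => c ((F.obj n).mulE x ⟨e, f⟩), h1⟩
      ⟨z.top e', fun f => d (colimMulE F z ⟨e', f⟩), h2⟩ where
  op := hx.top e e' he
  top f f' hf := hy.top _ _ (colimMulE_eq F hx e f e' f' he hf)

theorem colimS_mulE (z : (colimEndo F).TwoLevel) (e f) :
    colimS F (colimMulE F z ⟨e, f⟩).1 = colimS F f.1 := by
  obtain ⟨n, x, hx⟩ := exists_isImage F z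
  rw [colimMulE_eq F hx _ _ e f (inE_stageE F hx e) (inE_stageF F hx e f),
    inE_stageF F hx e f]
  exact congrArg (inI F n) ((F.obj n).s_mulE x _ _)

theorem isImage_outer {z : (colimEndo F).TwoLevel}
    {d : (colimEndo F).Fib (colimMul F z) → ColimB F} {hd : ∀ g, colimT F (d g) = colimS F g.1}
    {n : ℕ} {x : (F.obj n).TwoLevel} {c : (F.obj n).Fib ((F.obj n).mul x) → (F.obj n).B}
    {hc : ∀ g, (F.obj n).t (c g) = (F.obj n).s g.1} (hx : (colimPolyHom F n).IsImage x z)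
    (hy : (colimPolyHom F n).IsImage ⟨(F.obj n).mul x, c, hc⟩ ⟨colimMul F z, d, hd⟩)
    (h1 : ∀ e f, (F.obj n).t (c ((F.obj n).mulE x ⟨e, f⟩)) = (F.obj n).s f.1)
    (h2 : ∀ e : (F.obj n).Fib x.op, (F.obj n).t ((F.obj n).mul
      ⟨x.top e, fun f => c ((F.obj n).mulE x ⟨e, f⟩), h1 e⟩) = (F.obj n).s e.1)
    (h3 : ∀ e f, colimT F (d (colimMulE F z ⟨e, f⟩)) = colimS F f.1)
    (h4 : ∀ e : (colimEndo F).Fib z.op, colimT F (colimMul F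
      ⟨z.top e, fun f => d (colimMulE F z ⟨e, f⟩), h3 e⟩) = colimS F e.1) :
    (colimPolyHom F n).IsImage
      ⟨x.op, fun e => (F.obj n).mul ⟨x.top e, fun f => c ((F.obj n).mulE x ⟨e, f⟩), h1 e⟩, h2⟩
      ⟨z.op, fun e => colimMul F ⟨z.top e, fun f => d (colimMulE F z ⟨e, f⟩), h3 e⟩, h4⟩ where
  op := hx.op
  top e e' he := colimMul_eq F (isImage_inner F hx hy e e' he _ _)

/-- The union of a chain of polynomial monads: the sets of types, operations and partial operations
are the colimits of those of the stages, and the structure is inherited from the stages. -/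
noncomputable def seqColimit : PolyMonad.{u} where
  toPolyEndo := colimEndo F
  unit := colimUnit F
  t_unit i := by
    obtain ⟨n, i, rfl⟩ := exists_inI F i
    exact congrArg (inI F n) ((F.obj n).t_unit i)
  unitE i := ⟨colimUnitE' F i, colimUnitE_mem F i⟩
  unitE_unique i e := by
    obtain ⟨n, i, rfl⟩ := exists_inI F i
    obtain ⟨e', he'⟩ := (colimPolyHom F n).exists_lift (b := (F.obj n).unit i) e.2
    obtain rfl := (F.obj n).unitE_unique i e'
    exact Subtype.ext he'
  s_unitE i := by
    obtain ⟨n, i, rfl⟩ := exists_inI F i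
    exact congrArg (inI F n) ((F.obj n).s_unitE i)
  mul := colimMul F
  t_mul := colimMul_inB_t F
  mulE z := Equiv.ofBijective (colimMulE F z) (colimMulE_bijective F z)
  s_mulE z e f := colimS_mulE F z e f
  unit_mul i c hc := by
    obtain ⟨n, x, j, hx, hj, rfl⟩ := exists_unit_stage F ⟨colimUnit F i, c, hc⟩ i rfl
    rw [colimMul_eq F hx, unit_mul_of _ _ _ hj]
    exact (hx.top _ _ rfl).symm
  unit_mulE i c hc f := by
    obtain ⟨n, x, j, hx, hj, rfl⟩ := exists_unit_stage F ⟨colimUnit F i, c, hc⟩ i rfl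
    have hf := f.2.trans (hx.top ⟨((F.obj n).unitE j).1, ((F.obj n).unitE j).2.trans hj.symm⟩ _ rfl)
    obtain ⟨f', hf'⟩ := (colimPolyHom F n).exists_lift hf
    refine (colimMulE_eq F hx _ f' _ f rfl hf').trans ?_
    rw [unit_mulE_of _ _ _ hj]
    exact hf'.symm
  mul_unit b := by
    obtain ⟨n, b, rfl⟩ := exists_inB F b
    refine (colimMul_eq F (n := n) (x := ⟨b, fun e => (F.obj n).unit ((F.obj n).s e.1),
      fun _ => (F.obj n).t_unit _⟩) ⟨rfl, fun e e' he => ?_⟩).trans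
      (congrArg (inB F n) ((F.obj n).mul_unit b))
    change colimUnit F (colimS F e'.1) = _
    rw [he]
    rfl
  mulE_unit b e := by
    obtain ⟨n, b, rfl⟩ := exists_inB F b
    obtain ⟨e', he'⟩ := (colimPolyHom F n).exists_lift (b := b) e.2
    refine (colimMulE_eq F (n := n) (x := ⟨b, fun e => (F.obj n).unit ((F.obj n).s e.1),
      fun _ => (F.obj n).t_unit _⟩) ⟨rfl, fun e e' he => ?_⟩ e' ((F.obj n).unitE _) _ _ he'
      ?_).trans
      ((congrArg (inE F n) ((F.obj n).mulE_unit b e')).trans he'.symm)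
    · change colimUnit F (colimS F e'.1) = _
      rw [he]
      rfl
    · change colimUnitE' F (colimS F e.1) = _
      rw [he']
      rfl
  assoc z d hd := by
    obtain ⟨n, x, c, hc, hx, hy⟩ := exists_assoc_stage F z d hd
    refine (colimMul_eq F hy).trans ((congrArg (inB F n) ((F.obj n).assoc x c hc)).trans ?_)
    exact (colimMul_eq F (isImage_outer F hx hy _ _ _ _)).symm
  assocE z d hd e f g := by
    obtain ⟨n, x, c, hc, hx, hy⟩ := exists_assoc_stage F z d hd
    have he := inE_stageE F hx e
    have hf := inE_stageF F hx e f
    have hef := colimMulE_eq F hx _ _ e f he hf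
    obtain ⟨g', hg'⟩ := (colimPolyHom F n).exists_lift (g.2.trans (hy.top _ _ hef))
    refine (colimMulE_eq F hy _ g' _ g hef hg').trans
      ((congrArg (inE F n) ((F.obj n).assocE x c hc _ _ g')).trans ?_)
    refine (colimMulE_eq F (isImage_outer F hx hy _ _ _ _) _ _ _ _ he ?_).symm
    exact colimMulE_eq F (isImage_inner F hx hy _ e he _ _) _ g' f g hf hg'

/-- The inclusion of stage `n` into the union. -/
noncomputable def seqColimitIncl (n : ℕ) : F.obj n ⟶ seqColimit F :=
  ({ toPolyHom := colimPolyHom F n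
     onB_unit _ := rfl
     onB_mul _ _ h := (colimMul_eq F h).symm
     onE_mulE _ _ h e f e' f' he hf := (colimMulE_eq F h e f e' f' he hf).symm } :
    Hom (F.obj n) (seqColimit F))

end SeqColimit

end PolyMonad

open CategoryTheory CategoryTheory.Limits PolyMonad

/-- The trivial monad `Id`, represented by `1 ← 1 → 1 → 1`. -/
def idMonad : PolyMonad.{u} where
  I := PUnit
  B := PUnit
  E := PUnit
  s := id
  p := id
  t := id
  finite_fib _ := inferInstance
  unit := id
  t_unit _ := rfl
  unitE i := ⟨i, rfl⟩
  unitE_unique _ _ := rfl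
  s_unitE _ := rfl
  mul x := x.op
  t_mul _ := rfl
  mulE x := ⟨fun q => q.1, fun e => ⟨e, ⟨PUnit.unit, rfl⟩⟩, fun _ => rfl, fun _ => rfl⟩
  s_mulE _ _ _ := rfl
  unit_mul _ _ _ := rfl
  unit_mulE _ _ _ _ := rfl
  mul_unit _ := rfl
  mulE_unit _ _ := rfl
  assoc _ _ _ := rfl
  assocE _ _ _ _ _ _ := rfl

/-- The (unique) morphism from the trivial monad that maps the only type to `i`. -/
def pointHom (M : PolyMonad.{u}) (i : M.I) : idMonad ⟶ M :=
  ({ onI := fun _ => i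
     onB := fun _ => M.unit i
     onE := fun _ => (M.unitE i).1
     s_onE := fun _ => M.s_unitE i
     p_onE := fun _ => (M.unitE i).2
     t_onB := fun _ => M.t_unit i
     cartesian := fun b => ⟨fun _ _ _ => Subtype.ext rfl, fun e =>
       ⟨⟨b, rfl⟩, (M.unitE_unique i e).symm⟩⟩
     onB_unit := fun _ => rfl
     onB_mul := fun x y h => by
       refine Eq.trans ?_ (unit_mul_of M y i h.op).symm
       exact (h.top ⟨x.op, rfl⟩ _ rfl).symm
     onE_mulE := fun x y h e f e' f' he hf => by
       obtain rfl : e' = ⟨(M.unitE i).1, (M.unitE i).2.trans h.op.symm⟩ := Subtype.ext he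
       exact hf.symm.trans (unit_mulE_of M y i h.op f').symm } : Hom idMonad M)

/-- The polynomial monad `Pⁿ = BDⁿ(Id)`. Its types are the opetopes of dimension `n`, its operations
the opetopes of dimension `n + 1`, its partial operations the latter with a marked input facet. -/
noncomputable def opetopeMonad : ℕ → PolyMonad.{u}
  | 0 => idMonad
  | n + 1 => BD.obj (opetopeMonad n)

/-- The set of `n`-dimensional opetopes. -/
abbrev Opetope (n : ℕ) : Type u := (opetopeMonad.{u} n).I

/-- The suspension of opetopes as a morphism of polynomial monads `Pⁿ → Pⁿ⁺¹`; on types it maps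
an `n`-opetope to its suspension. The suspension `Id → BD(Id)` is the unique morphism between
these monads (the only type goes to the only type, the only operation to the one-node tree), and the
others arise from it by applying `BD`. -/
noncomputable def suspension : ∀ n, opetopeMonad.{u} n ⟶ opetopeMonad.{u} (n + 1)
  | 0 => pointHom (BD.obj idMonad) PUnit.unit
  | n + 1 => BD.map (suspension n)

/-- The chain `P⁰ → P¹ → P² → ⋯` of suspensions. -/
noncomputable def opetopeChain : ℕ ⥤ PolyMonad.{u} := Functor.ofSequence suspension

/-- The polynomial monad `P^∞` of stable opetopes: the union of the monads `Pⁿ` along suspension. -/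
noncomputable def stableMonad : PolyMonad.{u} := seqColimit opetopeChain

/-- The set of stable opetopes: opetopes of all dimensions, an opetope being identified with its
suspension. -/
abbrev StableOpetope : Type u := stableMonad.{u}.I

/-- The morphism `Pⁿ → P^∞` that sends an opetope to its class. -/
noncomputable def stableMonadIncl (n : ℕ) : opetopeMonad.{u} n ⟶ stableMonad.{u} :=
  seqColimitIncl opetopeChain n

theorem suspension_stableMonadIncl (n : ℕ) :
    suspension.{u} n ≫ stableMonadIncl (n + 1) = stableMonadIncl n := by
  have h : opetopeChain.{u}.map (homOfLE (Nat.le_add_right n 1)) = suspension n :=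
    Functor.ofSequence_map_homOfLE_succ _ _
  have key : ∀ f : opetopeMonad.{u} n ⟶ opetopeMonad (n + 1),
      opetopeChain.{u}.map (homOfLE (Nat.le_add_right n 1)) = f →
      f ≫ stableMonadIncl (n + 1) = stableMonadIncl n := by
    rintro _ rfl
    exact Hom.ext_of (fun i => inI_trans opetopeChain _ i) (fun i => inB_trans opetopeChain _ i)
      (fun i => inE_trans opetopeChain _ i)
  exact key _ h

/-- The category of pointed polynomial monads: monads `M` with a monad map `Id → M`. -/
abbrev PointedPolyMonad : Type (u + 1) := Under idMonad.{u}

/-- The pointed Baez–Dolan functor: it maps `i : Id → M` to the composite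
`Id → BD(Id) → BD(M)` of the suspension with `BD(i)`. -/
noncomputable def pointedBD : PointedPolyMonad.{u} ⥤ PointedPolyMonad.{u} :=
  Under.post BD ⋙ Under.map (suspension 0)

/-- The point of `BDⁿ(Id)` obtained by iterating the pointed Baez–Dolan functor. -/
noncomputable def opetopePoint : ∀ n, idMonad.{u} ⟶ opetopeMonad.{u} n
  | 0 => 𝟙 _
  | n + 1 => suspension 0 ≫ BD.map (opetopePoint n)

theorem opetopePoint_suspension : ∀ n,
    opetopePoint.{u} n ≫ suspension n = opetopePoint (n + 1)
  | 0 => by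
    refine (Category.id_comp _).trans ?_
    exact ((congrArg (suspension 0 ≫ ·) (BD.map_id idMonad)).trans (Category.comp_id _)).symm
  | n + 1 => by
    refine (Category.assoc _ _ _).trans ?_
    exact congrArg (suspension 0 ≫ ·) ((BD.map_comp _ _).symm.trans
      (congrArg BD.map (opetopePoint_suspension n)))

/-- The pointed polynomial monad `Pⁿ = BDⁿ(Id)`. -/
noncomputable def pointedOpetope (n : ℕ) : PointedPolyMonad.{u} := Under.mk (opetopePoint n)

theorem pointedOpetope_succ (n : ℕ) :
    pointedOpetope.{u} (n + 1) = pointedBD.obj (pointedOpetope n) := rfl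

/-- The suspension as a morphism of pointed monads. -/
noncomputable def pointedSuspension (n : ℕ) : pointedOpetope.{u} n ⟶ pointedOpetope (n + 1) :=
  Under.homMk (suspension n) (opetopePoint_suspension n)

theorem pointedSuspension_succ (n : ℕ) :
    pointedSuspension.{u} (n + 1) = pointedBD.map (pointedSuspension n) := rfl

/-- The chain `Id → BD(Id) → BD²(Id) → ⋯` of pointed polynomial monads. -/
noncomputable def pointedChain : ℕ ⥤ PointedPolyMonad.{u} := Functor.ofSequence pointedSuspension

/-- The monad of stable opetopes, pointed by the inclusion of `P⁰ = Id`. -/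
noncomputable def stablePointed : PointedPolyMonad.{u} := Under.mk (stableMonadIncl 0)

theorem opetopePoint_stableMonadIncl : ∀ n,
    opetopePoint.{u} n ≫ stableMonadIncl n = stableMonadIncl 0
  | 0 => Category.id_comp _
  | n + 1 => by
    rw [← opetopePoint_suspension, Category.assoc, suspension_stableMonadIncl,
      opetopePoint_stableMonadIncl n]

/-- The inclusion of `Pⁿ` into the monad of stable opetopes, as a pointed morphism. -/
noncomputable def stableIncl (n : ℕ) : pointedOpetope.{u} n ⟶ stablePointed :=
  Under.homMk (stableMonadIncl n) (opetopePoint_stableMonadIncl n)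

theorem pointedSuspension_stableIncl (n : ℕ) :
    pointedSuspension.{u} n ≫ stableIncl (n + 1) = stableIncl n :=
  Under.UnderMorphism.ext (suspension_stableMonadIncl n)

/-- The cocone of the inclusions `Pⁿ → P^∞`. -/
noncomputable def stableCocone : Cocone pointedChain.{u} where
  pt := stablePointed
  ι := NatTrans.ofSequence stableIncl fun n => by
    refine Eq.trans ?_ (Category.comp_id _).symm
    refine Eq.trans ?_ (pointedSuspension_stableIncl n)
    exact congrArg (· ≫ stableIncl (n + 1)) (Functor.ofSequence_map_homOfLE_succ _ _)

/-! This is Adámek's construction of an initial algebra as the colimit of the iterates of a functor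
on the initial object. In the category of monads under `Id` the object `(Id, id)` is initial, and
iterating the pointed `BD` on it gives the chain of suspensions, because `S_(n+1) = BD(S_n)`. If
`P^∞` is the colimit of this chain and `BD` preserves it, then `BD(P^∞)` is the colimit of the same
chain with its first term removed, hence isomorphic to `P^∞`, and the isomorphism is an initial
algebra.

The colimit property is a matter of sets. The diagram of `P^∞` is a levelwise colimit, and every
type, operation, partial operation and two-level tree of `P^∞` is represented at some stage.
Compatible morphisms from the stages therefore glue (`seqColimitDesc`) in exactly one way
(`seqColimit_hom_ext`), the monad laws being checked at a stage.

The essential point is that `BD` preserves this colimit. The comparison `stableUnfold : P^∞ →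
BD(P^∞)` restricts to `BD(ι_n)` on `P^(n+1)`. Since the middle square of a morphism is cartesian, it
is invertible as soon as it is bijective on types and on operations (`isIso_of_bijective`). On types
it is a reindexing: types of `P^(n+1)` are operations of `P^n`, and transition maps match by
`BD_map_opetopeChain`. On operations it compares classes of `P^n`-trees with `P^∞`-trees. Here
finiteness enters: operations have finitely many inputs and trees are well-founded, so all
decorations and all typing conditions of a `P^∞`-tree are realised at one stage (`exists_mapTree`),
and two trees that become equal in the colimit are already equal at some stage
(`exists_mapTree_eq`).

Passing to pointed monads costs nothing, since the stage `Id` of the chain carries the point. For an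
algebra `a : BD(A) → A`, the maps `Id → A` and `P^(n+1) = BD(P^n) → BD(A) → A` form a cocone. The
induced map `P^∞ → A` is an algebra morphism, and any algebra morphism satisfies the recursion that
defines this cocone. -/

namespace PolyMonad

open PreTree

/-! ### Isomorphisms of polynomial monads -/

section Bijective

variable {M N : PolyMonad.{u}} (f : Hom M N)

/-- The middle square is a pullback, so `onE` is a base change of `onB`. Partial operations with the
same image lie over the same operation, because `onB` is injective, and on a single fibre the map is
injective. For surjectivity, first lift the operation, then the input. -/
theorem Hom.bijective_onE (hB : Function.Bijective f.onB) : Function.Bijective f.onE := by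
  constructor
  · intro e e' h
    have hp : M.p e = M.p e' := hB.1 (((f.p_onE e).symm.trans (congrArg N.p h)).trans (f.p_onE e'))
    exact congrArg Subtype.val (f.onE_inj (b := M.p e') (e := ⟨e, hp⟩) (e' := ⟨e', rfl⟩) h)
  · intro e
    obtain ⟨b, hb⟩ := hB.2 (N.p e)
    obtain ⟨e', he'⟩ := f.exists_lift hb.symm
    exact ⟨e'.1, he'.symm⟩

/-- The inverse of a morphism that is bijective on types and operations. -/
noncomputable def Hom.inverse (hI : Function.Bijective f.onI) (hB : Function.Bijective f.onB) :
    Hom N M :=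
  let cI := Equiv.ofBijective _ hI
  let cB := Equiv.ofBijective _ hB
  let cE := Equiv.ofBijective _ (f.bijective_onE hB)
  have hcI (i) : f.onI (cI.symm i) = i := cI.apply_symm_apply i
  have hcB (b) : f.onB (cB.symm b) = b := cB.apply_symm_apply b
  have hcE (e) : f.onE (cE.symm e) = e := cE.apply_symm_apply e
  -- Each identity required of the inverse is checked after applying `f`, which is injective on the
  -- set in question.
  have hp (e) : M.p (cE.symm e) = cB.symm (N.p e) :=
    hB.1 ((f.p_onE _).symm.trans ((congrArg N.p (hcE e)).trans (hcB _).symm))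
  { onI := cI.symm
    onB := cB.symm
    onE := cE.symm
    s_onE e := hI.1 ((f.s_onE _).symm.trans ((congrArg N.s (hcE e)).trans (hcI _).symm))
    p_onE := hp
    t_onB b := hI.1 ((f.t_onB _).symm.trans ((congrArg N.t (hcB b)).trans (hcI _).symm))
    cartesian b := by
      constructor
      · intro e e' h
        exact Subtype.ext (cE.symm.injective (congrArg Subtype.val h))
      · intro e
        refine ⟨⟨f.onE e.1, (f.p_onE e.1).trans ((congrArg f.onB e.2).trans (hcB b))⟩, ?_⟩
        exact Subtype.ext (cE.symm_apply_apply e.1)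
    onB_unit i := hB.1 (by rw [hcB, f.onB_unit, hcI])
    -- If `y` is the image of `x` under the inverse, then `x` is the image of `y` under `f`, so the
    -- law for `f` is read backwards. The same exchange serves for `onE_mulE`.
    onB_mul x y h := hB.1 (by
      rw [hcB]
      refine (f.onB_mul y x ⟨by rw [h.op, hcB], fun e e' he => ?_⟩).symm
      rw [h.top e' e (by rw [he]; exact (cE.symm_apply_apply e.1).symm), hcB])
    onE_mulE x y h e k e' k' he hk := (f.bijective_onE hB).1 (by
      rw [hcE]
      refine (f.onE_mulE y x ⟨by rw [h.op, hcB], fun e e' he => ?_⟩ e' k' e k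
        (by rw [he, hcE]) (by rw [hk, hcE])).symm
      rw [h.top e' e (by rw [he]; exact (cE.symm_apply_apply e.1).symm), hcB]) }

/-- Reduces the fixpoint claim to two bijections of sets; marked inputs need no separate comparison.
-/
theorem isIso_of_bijective {M N : PolyMonad.{u}} (f : M ⟶ N)
    (hI : Function.Bijective (Hom.toPolyHom f).onI)
    (hB : Function.Bijective (Hom.toPolyHom f).onB) : IsIso f :=
  ⟨Hom.inverse f hI hB,
    Hom.ext_of (fun i => (Equiv.ofBijective _ hI).symm_apply_apply i)
      (fun b => (Equiv.ofBijective _ hB).symm_apply_apply b)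
      (fun e => (Equiv.ofBijective _ (Hom.bijective_onE f hB)).symm_apply_apply e),
    Hom.ext_of (fun i => (Equiv.ofBijective _ hI).apply_symm_apply i)
      (fun b => (Equiv.ofBijective _ hB).apply_symm_apply b)
      (fun e => (Equiv.ofBijective _ (Hom.bijective_onE f hB)).apply_symm_apply e)⟩

end Bijective

/-! ### Universal property of the union of a chain -/

section Descent

variable (F : ℕ ⥤ PolyMonad.{u})

/-- The morphism from the union of a chain that is induced by a cocone. -/
noncomputable def seqColimitDesc (c : Cocone F) : seqColimit F ⟶ c.pt :=
  let g (n : ℕ) : Hom (F.obj n) c.pt := c.ι.app n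
  have w {n m : ℕ} (f : n ⟶ m) : Hom.comp (F.map f) (g m) = g n := c.w f
  -- Two representatives are identified along a transition map, and the cocone is invariant under
  -- transition maps.
  let dI : ColimI F → c.pt.I := Quot.lift (fun x => (g x.1).onI x.2) (by
    rintro ⟨n, i⟩ ⟨m, j⟩ ⟨f, hf⟩
    exact (congrArg (fun h : Hom (F.obj n) c.pt => h.onI i) (w f).symm).trans
      (congrArg (g m).onI hf.symm))
  let dB : ColimB F → c.pt.B := Quot.lift (fun x => (g x.1).onB x.2) (by
    rintro ⟨n, i⟩ ⟨m, j⟩ ⟨f, hf⟩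
    exact (congrArg (fun h : Hom (F.obj n) c.pt => h.onB i) (w f).symm).trans
      (congrArg (g m).onB hf.symm))
  let dE : ColimE F → c.pt.E := Quot.lift (fun x => (g x.1).onE x.2) (by
    rintro ⟨n, i⟩ ⟨m, j⟩ ⟨f, hf⟩
    exact (congrArg (fun h : Hom (F.obj n) c.pt => h.onE i) (w f).symm).trans
      (congrArg (g m).onE hf.symm))
  have hp (e) : c.pt.p (dE e) = dB (colimP F e) := by
    obtain ⟨n, e, rfl⟩ := exists_inE F e
    exact (g n).p_onE e
  let d : PolyHom (colimEndo F) c.pt.toPolyEndo :=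
    { onI := dI
      onB := dB
      onE := dE
      s_onE e := by
        obtain ⟨n, e, rfl⟩ := exists_inE F e
        exact (g n).s_onE e
      p_onE := hp
      t_onB b := by
        obtain ⟨n, b, rfl⟩ := exists_inB F b
        exact (g n).t_onB b
      cartesian b := by
        obtain ⟨n, b, rfl⟩ := exists_inB F b
        -- The fibre map of `g n` over `b` factors as the bijection from the inputs of `b` to the
        -- inputs of its class, followed by the fibre map of `d`. The first factor can be cancelled.
        exact (Function.Bijective.of_comp_iff _ (inE_bijective F n b)).1 ((g n).cartesian b) }
  -- A two-level tree `z` of the union has a representative `x` at some stage. An image of `z` under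
  -- `d` is then an image of `x` under `g n`, so both multiplication laws follow from those of `g
  -- n`.
  have him {n : ℕ} {x z} {y : c.pt.TwoLevel} (hx : (colimPolyHom F n).IsImage x z)
      (hy : d.IsImage z y) : (g n).IsImage x y :=
    ⟨hy.op.trans (congrArg dB hx.op), fun e e' he =>
      (hy.top ((colimPolyHom F n).fib e |> fun q => ⟨q.1, q.2.trans hx.op.symm⟩) e' he).trans
        (congrArg dB (hx.top e _ rfl))⟩
  ({ d with
     onB_unit i := by
      obtain ⟨n, i, rfl⟩ := exists_inI F i
      exact (g n).onB_unit i
     onB_mul z y h := by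
      obtain ⟨n, x, hx⟩ := exists_isImage F z
      exact (congrArg dB (colimMul_eq F hx)).trans ((g n).onB_mul x y (him hx h))
     onE_mulE z y h e f e' f' he hf := by
      obtain ⟨n, x, hx⟩ := exists_isImage F z
      refine (congrArg dE (colimMulE_eq F hx _ _ e f (inE_stageE F hx e)
        (inE_stageF F hx e f))).trans ?_
      exact (g n).onE_mulE x y (him hx h) _ _ e' f'
        (he.trans (congrArg dE (inE_stageE F hx e))) (hf.trans (congrArg dE (inE_stageF F hx e f))) } :
    Hom (seqColimit F) c.pt)

theorem seqColimitIncl_desc (c : Cocone F) (n : ℕ) :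
    seqColimitIncl F n ≫ seqColimitDesc F c = c.ι.app n := rfl

/-- The inclusions of the stages are jointly surjective on types, operations and partial operations.
-/
theorem seqColimit_hom_ext {N : PolyMonad.{u}} {f g : seqColimit F ⟶ N}
    (h : ∀ n, seqColimitIncl F n ≫ f = seqColimitIncl F n ≫ g) : f = g := by
  refine Hom.ext_of (fun x => ?_) (fun x => ?_) (fun x => ?_)
  · obtain ⟨n, i, rfl⟩ := exists_inI F x
    exact congrArg (fun k : Hom (F.obj n) N => k.onI i) (h n)
  · obtain ⟨n, i, rfl⟩ := exists_inB F x
    exact congrArg (fun k : Hom (F.obj n) N => k.onB i) (h n)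
  · obtain ⟨n, i, rfl⟩ := exists_inE F x
    exact congrArg (fun k : Hom (F.obj n) N => k.onE i) (h n)

end Descent

/-! ### Trees commute with the colimit of a chain -/

section Trees

variable (F : ℕ ⥤ PolyMonad.{u})

theorem trans_comp_seqColimitIncl {n m : ℕ} (h : n ≤ m) :
    (trans F h).comp (seqColimitIncl F m) = seqColimitIncl F n :=
  Hom.ext_of (inI_trans F h) (inB_trans F h) (inE_trans F h)

theorem mapTree_trans {n m k : ℕ} (h : n ≤ m) (h' : m ≤ k) (T : PreTree (F.obj n).toPolyEndo) :
    mapTree (trans F (h.trans h')) T = mapTree (trans F h') (mapTree (trans F h) T) := by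
  rw [trans_comp F h h', mapTree_comp]

theorem mapTree_seqColimitIncl {n m : ℕ} (h : n ≤ m) (T : PreTree (F.obj n).toPolyEndo) :
    mapTree (seqColimitIncl F m) (mapTree (trans F h) T) = mapTree (seqColimitIncl F n) T := by
  rw [← mapTree_comp, trans_comp_seqColimitIncl]

theorem inI_eq {n : ℕ} {i i'} (h : inI F n i = inI F n i') :
    ∃ k, ∃ (hn : n ≤ k), (trans F hn).onI i = (trans F hn).onI i' := by
  obtain ⟨k, f, hk⟩ := ((F ⋙ typFunctor).ιColimitType_eq_iff_of_isFiltered' i i').1 h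
  exact ⟨k, leOfHom f, hk⟩

/-- The families of subtrees are indexed by fibres over different operations. Comparing them at the
underlying partial operation `e` avoids transport along `b = b'`; `node_eq` is the converse. -/
theorem node_congr {P : PolyEndo.{u}} {b b' : P.B} {ch : P.Fib b → PreTree P}
    {ch' : P.Fib b' → PreTree P} (hb : b = b') (h : ∀ e he he', ch ⟨e, he⟩ = ch' ⟨e, he'⟩) :
    node b ch = node b' ch' := by
  subst hb
  congr 1
  funext e
  exact h e.1 e.2 e.2

theorem node_eq {P : PolyEndo.{u}} {b b' : P.B} {ch : P.Fib b → PreTree P}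
    {ch' : P.Fib b' → PreTree P} (h : node b ch = node b' ch') :
    b = b' ∧ ∀ e he he', ch ⟨e, he⟩ = ch' ⟨e, he'⟩ := by
  cases h
  exact ⟨rfl, fun _ _ _ => rfl⟩

/-- Trees with the same image in the union of a chain have the same image at some stage. -/
theorem exists_mapTree_eq : ∀ {n : ℕ} (T T' : PreTree (F.obj n).toPolyEndo)
    (_ : mapTree (seqColimitIncl F n) T = mapTree (seqColimitIncl F n) T'),
    ∃ k, ∃ h : n ≤ k, mapTree (trans F h) T = mapTree (trans F h) T' := by
  intro n T
  induction T with
  | edge i =>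
    rintro (i' | ⟨b', ch'⟩) h
    · obtain ⟨k, hk, h'⟩ := inI_eq F (PreTree.edge.inj h)
      exact ⟨k, hk, congrArg edge h'⟩
    · cases h
  | node b ch ih =>
    rintro (i' | ⟨b', ch'⟩) h
    · cases h
    obtain ⟨hb, hch⟩ := node_eq h
    obtain ⟨m, hm, hm', hbm⟩ := inB_eq F (show inB F n b = inB F n b' from hb)
    -- At stage `m` the two root operations have the same image, whose inputs are in bijection with
    -- those of `b` and with those of `b'`. This matches inputs of `b` with inputs of `b'`, although
    -- `b` and `b'` may differ at stage `n`.
    have hfib (e : (F.obj n).Fib b) : ∃ e' : (F.obj n).Fib b',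
        (trans F hm).onE e.1 = (trans F hm).onE e'.1 :=
      (trans F hm).exists_lift (((trans F hm).fib e).2.trans hbm)
    choose r hr using hfib
    have hrI (e : (F.obj n).Fib b) : inE F n e.1 = inE F n (r e).1 := by
      rw [← inE_trans F hm, hr, inE_trans]
    -- Matched inputs have the same class in the colimit, so the subtrees planted there have the
    -- same image and the induction hypothesis applies to them.
    have key (e : (F.obj n).Fib b) : mapTree (seqColimitIncl F n) (ch e) =
        mapTree (seqColimitIncl F n) (ch' (r e)) := by
      refine (mapTree_child (seqColimitIncl F n) b ch e).symm.trans (Eq.trans ?_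
        (mapTree_child (seqColimitIncl F n) b' ch' (r e)))
      refine (hch _ ((Hom.toPolyHom (seqColimitIncl F n)).fib e).2
        (((Hom.toPolyHom (seqColimitIncl F n)).fib e).2.trans hb)).trans ?_
      congr 3
      exact Subtype.ext (hrI e)
    choose k hk hkk using fun e => ih e (ch' (r e)) (key e)
    have := (F.obj n).finite_fib b
    -- Since `b` has finitely many inputs, the stages at which the pairs of subtrees agree are
    -- bounded. The stage `m + K` lies beyond all of them and beyond `m`, where the roots agree.
    obtain ⟨K, hK⟩ := (Set.finite_range k).bddAbove
    have hmK : m ≤ m + K := Nat.le_add_right _ _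
    refine ⟨m + K, hm.trans hmK, ?_⟩
    refine node_congr ?_ fun e he he' => ?_
    · rw [trans_comp F hm hmK]
      exact congrArg (trans F hmK).onB hbm
    -- An input of the common root at stage `m + K` lifts to `e0` on one side and to `r e0` on the
    -- other, so the equality to prove is the one supplied for the matched pair.
    · obtain ⟨e0, h0⟩ := (trans F (hm.trans hmK)).exists_lift he
      have h1 : e = (trans F (hm.trans hmK)).onE (r e0).1 := by
        rw [h0, trans_comp F hm hmK]
        exact congrArg (trans F hmK).onE (hr e0)
      have l0 : (trans F (hm.trans hmK)).lift ⟨e, he⟩ = e0 :=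
        (trans F (hm.trans hmK)).onE_inj (((trans F (hm.trans hmK)).onE_lift _).trans h0)
      have l1 : (trans F (hm.trans hmK)).lift ⟨e, he'⟩ = r e0 :=
        (trans F (hm.trans hmK)).onE_inj (((trans F (hm.trans hmK)).onE_lift _).trans h1)
      rw [l0, l1]
      have hkK : k e0 ≤ m + K := (hK ⟨e0, rfl⟩).trans (Nat.le_add_left _ _)
      exact (mapTree_trans F (hk e0) hkK _).trans
        ((congrArg (mapTree (trans F hkK)) (hkk e0)).trans (mapTree_trans F (hk e0) hkK _).symm)

/-- Every tree over the union of a chain comes from some stage. -/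
theorem exists_mapTree : ∀ (T : PreTree (colimEndo F)) (_ : T.WF),
    ∃ n, ∃ T' : PreTree (F.obj n).toPolyEndo, T'.WF ∧ mapTree (seqColimitIncl F n) T' = T
  | edge i, _ => by
    obtain ⟨n, i, rfl⟩ := exists_inI F i
    exact ⟨n, edge i, trivial, rfl⟩
  | node b ch, w => by
    choose k S hS hST using fun e => exists_mapTree (ch e) (w e).2
    obtain ⟨n, b, rfl⟩ := exists_inB F b
    have := (F.obj n).finite_fib b
    let g := colimPolyHom F n
    -- The inputs of the class of `b` are those of `b`, hence finite in number, and the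
    -- representatives of all the subtrees can be moved to a common stage.
    obtain ⟨K, hK⟩ := (Set.finite_range fun e : (F.obj n).Fib b => k (g.fib e)).bddAbove
    have hkm (e : (F.obj n).Fib b) : k (g.fib e) ≤ n + K :=
      (hK ⟨e, rfl⟩).trans (Nat.le_add_left _ _)
    have hnm : n ≤ n + K := Nat.le_add_right _ _
    generalize n + K = m at hkm hnm
    -- At stage `m` the root type of a representing subtree need not equal the type of its input:
    -- they are only known to agree in the colimit. A later stage `l` realises these finitely many
    -- equalities, which is what makes the assembled tree well-formed.
    obtain ⟨l, hml, hl⟩ := exists_eq_I F (A := (F.obj n).Fib b) (m := m)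
      (fun e => (mapTree (trans F (hkm e)) (S (g.fib e))).root)
      (fun e => (trans F hnm).onI ((F.obj n).s e.1)) (by
        intro e
        refine Eq.trans ?_ (inI_trans F hnm _).symm
        refine Eq.trans ?_ (w (g.fib e)).1
        rw [← hST (g.fib e), ← mapTree_seqColimitIncl F (hkm e)]
        exact (root_mapTree (seqColimitIncl F m) _).symm)
    let t := trans F (hnm.trans hml)
    refine ⟨l, node (t.onB b) fun e =>
      mapTree (trans F ((hkm (t.lift e)).trans hml)) (S (g.fib (t.lift e))), fun e => ⟨?_, ?_⟩, ?_⟩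
    · refine (congrArg root (mapTree_trans F (hkm _) hml _)).trans ?_
      rw [root_mapTree, hl]
      obtain ⟨e, rfl⟩ : ∃ e0, e = t.fib e0 := ⟨_, (t.fib_lift e).symm⟩
      rw [PolyHom.lift_fib]
      refine Eq.trans ?_ (t.s_onE _).symm
      simp only [t]
      rw [trans_comp F hnm hml]
      rfl
    · exact mapTree_wf _ (hS _)
    · refine node_congr (inB_trans F (hnm.trans hml) b) fun e he he' => ?_
      -- It remains to see that an input of the colimit operation, lifted to stage `l` and then to
      -- stage `n`, has the original input as its class.
      refine (mapTree_seqColimitIncl F _ _).trans ((hST _).trans (congrArg ch (Subtype.ext ?_)))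
      refine (inE_trans F (hnm.trans hml) _).symm.trans ?_
      refine (congrArg (inE F l) (t.onE_lift _)).trans ?_
      exact (Hom.toPolyHom (seqColimitIncl F l)).onE_lift ⟨e, he⟩

end Trees

/-! ### The chain of opetope monads and its shift -/

theorem opetopeChain_map_succ (n : ℕ) :
    opetopeChain.{u}.map (homOfLE (Nat.le_add_right n 1)) = suspension n :=
  Functor.ofSequence_map_homOfLE_succ _ _

/-- The Baez–Dolan functor shifts the chain of opetopes by one. -/
theorem BD_map_opetopeChain {n k : ℕ} (h : n ≤ k) :
    BD.map (opetopeChain.{u}.map (homOfLE h)) =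
      opetopeChain.map (homOfLE (Nat.succ_le_succ h)) := by
  induction k, h using Nat.le_induction with
  | base =>
    have h1 : opetopeChain.{u}.map (homOfLE le_rfl) = 𝟙 (opetopeMonad n) :=
      opetopeChain.map_id n
    exact (congrArg BD.map h1).trans ((BD.map_id _).trans (opetopeChain.map_id (n + 1)).symm)
  -- Split off the last suspension on both sides; `suspension (k + 1)` is by definition `BD` of
  -- `suspension k`.
  | succ k h ih =>
    have h1 : opetopeChain.{u}.map (homOfLE (h.trans (Nat.le_add_right k 1))) =
        opetopeChain.map (homOfLE h) ≫ suspension k :=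
      (opetopeChain.map_comp (homOfLE h) (homOfLE (Nat.le_add_right k 1))).trans
        (congrArg (opetopeChain.map (homOfLE h) ≫ ·) (opetopeChain_map_succ k))
    have h2 : opetopeChain.{u}.map (homOfLE (Nat.succ_le_succ (h.trans (Nat.le_add_right k 1)))) =
        opetopeChain.map (homOfLE (Nat.succ_le_succ h)) ≫ suspension (k + 1) :=
      (opetopeChain.map_comp (homOfLE (Nat.succ_le_succ h))
        (homOfLE (Nat.le_add_right (k + 1) 1))).trans
        (congrArg (opetopeChain.map _ ≫ ·) (opetopeChain_map_succ (k + 1)))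
    exact (congrArg BD.map h1).trans ((BD.map_comp _ _).trans
      ((congrArg (· ≫ suspension (k + 1)) ih).trans h2.symm))

/-- A cocone on the chain of opetopes from morphisms compatible with suspension. -/
noncomputable def opetopeCocone (N : PolyMonad.{u}) (g : ∀ n, opetopeMonad.{u} n ⟶ N)
    (h : ∀ n, suspension n ≫ g (n + 1) = g n) : Cocone opetopeChain.{u} where
  pt := N
  ι := NatTrans.ofSequence g fun n => by
    refine Eq.trans ?_ (Category.comp_id _).symm
    exact (congrArg (· ≫ g (n + 1)) (opetopeChain_map_succ n)).trans (h n)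

/-- The morphism out of the monad of stable opetopes induced by morphisms compatible with
suspension. -/
noncomputable def stableDesc (N : PolyMonad.{u}) (g : ∀ n, opetopeMonad.{u} n ⟶ N)
    (h : ∀ n, suspension n ≫ g (n + 1) = g n) : stableMonad.{u} ⟶ N :=
  seqColimitDesc opetopeChain (opetopeCocone N g h)

theorem stableMonadIncl_desc (N : PolyMonad.{u}) (g : ∀ n, opetopeMonad.{u} n ⟶ N)
    (h : ∀ n, suspension n ≫ g (n + 1) = g n) (n : ℕ) :
    stableMonadIncl n ≫ stableDesc N g h = g n :=
  seqColimitIncl_desc opetopeChain (opetopeCocone N g h) n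

theorem stableMonad_hom_ext {N : PolyMonad.{u}} {f g : stableMonad.{u} ⟶ N}
    (h : ∀ n, stableMonadIncl n ≫ f = stableMonadIncl n ≫ g) : f = g :=
  seqColimit_hom_ext opetopeChain h

/-! ### The comparison `P^∞ → BD(P^∞)` is invertible -/

/-- The comparison morphism `P^∞ → BD(P^∞)`. -/
noncomputable def stableUnfold : stableMonad.{u} ⟶ BD.obj stableMonad.{u} :=
  stableDesc _ (fun n => suspension n ≫ BD.map (stableMonadIncl n)) fun n => by
    -- Precomposing `BD(ι_n)` with `S_n` also gives a leg at stage `0`, which is not of the form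
    -- `BD(P^n)`. Compatibility comes from `S_(n+1) = BD(S_n)` and functoriality.
    refine congrArg (suspension n ≫ ·) ((BD.map_comp (suspension n) _).symm.trans ?_)
    exact congrArg BD.map (suspension_stableMonadIncl n)

theorem stableMonadIncl_unfold (n : ℕ) :
    stableMonadIncl.{u} n ≫ stableUnfold = suspension n ≫ BD.map (stableMonadIncl n) :=
  stableMonadIncl_desc _ _ _ n

/-- The extra suspension is absorbed: `S_(n+1)` followed by `BD(ι_(n+1))` is `BD` of `S_n` followed
by `ι_(n+1)`, that is `BD(ι_n)`. All later computations with the comparison rest on this form. -/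
theorem stableMonadIncl_succ_unfold (n : ℕ) :
    stableMonadIncl.{u} (n + 1) ≫ stableUnfold = BD.map (stableMonadIncl n) :=
  (stableMonadIncl_unfold (n + 1)).trans ((BD.map_comp (suspension n) _).symm.trans
    (congrArg BD.map (suspension_stableMonadIncl n)))

/-- On types the comparison only changes the reading of `b`: from a type at stage `n + 1` to an
operation at stage `n`. -/
theorem stableUnfold_onI (n : ℕ) (b : (opetopeMonad.{u} n).B) :
    (Hom.toPolyHom stableUnfold).onI (inI opetopeChain (n + 1) b) = inB opetopeChain n b :=
  congrArg (fun f : Hom (opetopeMonad (n + 1)) (BD.obj stableMonad) => f.onI b)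
    (stableMonadIncl_succ_unfold n)

/-- On operations the class of a tree goes to the tree of classes, so bijectivity here says that
forming trees commutes with the colimit. -/
theorem stableUnfold_onB (n : ℕ) (T : (opetopeMonad.{u} n).Tree) :
    (Hom.toPolyHom stableUnfold).onB (inB opetopeChain (n + 1) T) =
      mapT (seqColimitIncl opetopeChain n) T :=
  congrArg (fun f : Hom (opetopeMonad (n + 1)) (BD.obj stableMonad) => f.onB T)
    (stableMonadIncl_succ_unfold n)

/-- Two stable types are moved to a common stage which is a successor, so that they can be read as
operations one stage earlier. -/
theorem exists_inI_succ_pair (x y : stableMonad.{u}.I) :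
    ∃ n, ∃ b c : (opetopeMonad.{u} n).B,
      inI opetopeChain (n + 1) b = x ∧ inI opetopeChain (n + 1) c = y := by
  obtain ⟨n, i, rfl⟩ := exists_inI opetopeChain x
  obtain ⟨m, j, rfl⟩ := exists_inI opetopeChain y
  exact ⟨n + m, (trans opetopeChain (show n ≤ n + m + 1 by omega)).onI i,
    (trans opetopeChain (show m ≤ n + m + 1 by omega)).onI j, inI_trans _ _ _, inI_trans _ _ _⟩

theorem exists_inB_succ_pair (x y : stableMonad.{u}.B) :
    ∃ n, ∃ b c : (opetopeMonad.{u} n).Tree,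
      inB opetopeChain (n + 1) b = x ∧ inB opetopeChain (n + 1) c = y := by
  obtain ⟨n, i, rfl⟩ := exists_inB opetopeChain x
  obtain ⟨m, j, rfl⟩ := exists_inB opetopeChain y
  exact ⟨n + m, (trans opetopeChain (show n ≤ n + m + 1 by omega)).onB i,
    (trans opetopeChain (show m ≤ n + m + 1 by omega)).onB j, inB_trans _ _ _, inB_trans _ _ _⟩

theorem stableUnfold_onI_bijective :
    Function.Bijective (Hom.toPolyHom stableUnfold.{u}).onI := by
  constructor
  · intro x y h
    obtain ⟨n, b, c, rfl, rfl⟩ := exists_inI_succ_pair x y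
    obtain ⟨k, hk, hk', h'⟩ := inB_eq opetopeChain
      ((stableUnfold_onI n b).symm.trans (h.trans (stableUnfold_onI n c)))
    -- The equality found holds for transition maps on operations from `n` to `k`. The shift of the
    -- chain by `BD` turns it into one for transition maps on types from `n + 1` to `k + 1`.
    have hs (z : (opetopeMonad n).B) :
        (trans opetopeChain hk).onB z = (trans opetopeChain (Nat.succ_le_succ hk)).onI z :=
      congrArg (fun f : Hom (opetopeMonad (n + 1)) (opetopeMonad (k + 1)) => f.onI z)
        (BD_map_opetopeChain hk)
    refine (inI_trans opetopeChain (Nat.succ_le_succ hk) b).symm.trans (Eq.trans ?_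
      (inI_trans opetopeChain (Nat.succ_le_succ hk) c))
    exact congrArg (inI opetopeChain (k + 1)) ((hs b).symm.trans (h'.trans (hs c)))
  · intro x
    obtain ⟨n, b, rfl⟩ := exists_inB opetopeChain x
    exact ⟨_, stableUnfold_onI n b⟩

/-- Injectivity is `exists_mapTree_eq`, transferred along the shift of the chain as for types;
surjectivity is `exists_mapTree`. -/
theorem stableUnfold_onB_bijective :
    Function.Bijective (Hom.toPolyHom stableUnfold.{u}).onB := by
  constructor
  · intro x y h
    obtain ⟨n, S, T, rfl, rfl⟩ := exists_inB_succ_pair x y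
    obtain ⟨k, hk, h'⟩ := exists_mapTree_eq opetopeChain S.1 T.1 (congrArg Subtype.val
      ((stableUnfold_onB n S).symm.trans (h.trans (stableUnfold_onB n T))))
    have hs (z : (opetopeMonad n).Tree) : mapT (trans opetopeChain hk) z =
        (trans opetopeChain (Nat.succ_le_succ hk)).onB z :=
      congrArg (fun f : Hom (opetopeMonad (n + 1)) (opetopeMonad (k + 1)) => f.onB z)
        (BD_map_opetopeChain hk)
    refine (inB_trans opetopeChain (Nat.succ_le_succ hk) S).symm.trans (Eq.trans ?_
      (inB_trans opetopeChain (Nat.succ_le_succ hk) T))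
    exact congrArg (inB opetopeChain (k + 1)) ((hs S).symm.trans ((Subtype.ext h').trans (hs T)))
  · rintro ⟨T, w⟩
    obtain ⟨n, S, hS, rfl⟩ := exists_mapTree opetopeChain T w
    exact ⟨_, stableUnfold_onB n ⟨S, hS⟩⟩

instance : IsIso stableUnfold.{u} :=
  isIso_of_bijective _ stableUnfold_onI_bijective stableUnfold_onB_bijective

/-! ### The fixpoint and the colimit among pointed monads -/

/-- The isomorphism `BD(P^∞) ≅ P^∞` of pointed monads. -/
noncomputable def stableFixpoint : pointedBD.obj stablePointed.{u} ≅ stablePointed :=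
  (Under.isoMk (f := stablePointed) (g := pointedBD.obj stablePointed)
    (asIso stableUnfold : stableMonad ≅ BD.obj stableMonad)
    -- The case `n = 0` is exactly the preservation of points: the point of `BD(P^∞)` is `S_0`
    -- followed by `BD(ι_0)`.
    (stableMonadIncl_unfold 0)).symm

theorem stableIncl_succ_unfold (n : ℕ) :
    stableIncl.{u} (n + 1) ≫ stableFixpoint.inv = pointedBD.map (stableIncl n) :=
  Under.UnderMorphism.ext (stableMonadIncl_succ_unfold n)

theorem BD_map_stableIncl_fixpoint (n : ℕ) :
    pointedBD.map (stableIncl.{u} n) ≫ stableFixpoint.hom = stableIncl (n + 1) :=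
  ((Iso.comp_inv_eq stableFixpoint).1 (stableIncl_succ_unfold n)).symm

theorem stablePointed_hom_ext {N : PointedPolyMonad.{u}} {f g : stablePointed.{u} ⟶ N}
    (h : ∀ n, stableIncl n ≫ f = stableIncl n ≫ g) : f = g :=
  Under.UnderMorphism.ext (stableMonad_hom_ext fun n => congrArg CommaMorphism.right (h n))

/-- The morphism of pointed monads out of the monad of stable opetopes induced by morphisms
compatible with suspension. -/
noncomputable def pointedDesc (N : PointedPolyMonad.{u}) (g : ∀ n, pointedOpetope.{u} n ⟶ N)
    (h : ∀ n, pointedSuspension n ≫ g (n + 1) = g n) : stablePointed.{u} ⟶ N :=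
  Under.homMk (stableDesc N.right (fun n => (g n).right)
    fun n => congrArg CommaMorphism.right (h n))
    -- The source of `g 0` is `Id` pointed by the identity, so `g 0` is itself the point of `N`. The
    -- glued map restricts to `g 0` at stage `0` and hence preserves points.
    ((stableMonadIncl_desc _ _ _ 0).trans
      ((Category.id_comp _).symm.trans (Under.w (g 0))))

theorem stableIncl_desc (N : PointedPolyMonad.{u}) (g : ∀ n, pointedOpetope.{u} n ⟶ N)
    (h : ∀ n, pointedSuspension n ≫ g (n + 1) = g n) (n : ℕ) :
    stableIncl n ≫ pointedDesc N g h = g n :=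
  Under.UnderMorphism.ext (stableMonadIncl_desc _ _ _ n)

theorem pointedCocone_w (c : Cocone pointedChain.{u}) (n : ℕ) :
    pointedSuspension n ≫ c.ι.app (n + 1) = c.ι.app n :=
  (congrArg (· ≫ c.ι.app (n + 1))
    (Functor.ofSequence_map_homOfLE_succ pointedSuspension n).symm).trans (c.w (homOfLE (Nat.le_add_right n 1)))

/-- The pointed monad of stable opetopes is the colimit of the chain of suspensions. -/
noncomputable def stableCoconeIsColimit : IsColimit stableCocone.{u} where
  desc c := pointedDesc c.pt (fun n => c.ι.app n) (pointedCocone_w c)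
  fac _ n := stableIncl_desc _ _ _ n
  uniq _ _ hf := stablePointed_hom_ext fun n => (hf n).trans (stableIncl_desc _ _ _ n).symm

/-! ### Initiality of the algebra -/

/-- The iterates of the structure map of an algebra for the pointed Baez–Dolan functor. -/
noncomputable def algebraIterate (A : Endofunctor.Algebra pointedBD.{u}) :
    ∀ n, pointedOpetope.{u} n ⟶ A.a
  -- `(Id, id)` is initial among pointed monads, so the point of `A` is the only choice.
  | 0 => Under.homMk A.a.hom (Category.id_comp _)
  | n + 1 => pointedBD.map (algebraIterate A n) ≫ A.str

/-- The base case is the initiality of `(Id, id)`: a pointed map out of it can only be the point.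
The inductive step is the previous case under `BD`, followed by the structure map. -/
theorem pointedSuspension_algebraIterate (A : Endofunctor.Algebra pointedBD.{u}) : ∀ n,
    pointedSuspension n ≫ algebraIterate A (n + 1) = algebraIterate A n
  | 0 => Under.UnderMorphism.ext ((Category.id_comp _).symm.trans
      (Under.w (pointedSuspension 0 ≫ algebraIterate A 1)))
  | n + 1 => by
    rw [pointedSuspension_succ]
    refine (Category.assoc _ _ _).symm.trans (congrArg (· ≫ A.str) ?_)
    exact (pointedBD.map_comp _ _).symm.trans
      (congrArg pointedBD.map (pointedSuspension_algebraIterate A n))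

/-- The morphism from the monad of stable opetopes to an algebra. -/
noncomputable def stableFold (A : Endofunctor.Algebra pointedBD.{u}) : stablePointed.{u} ⟶ A.a :=
  pointedDesc A.a (algebraIterate A) (pointedSuspension_algebraIterate A)

/-- After moving the isomorphism across, both sides are maps out of `P^∞`, so they may be compared
on stages. On `P^(n+1)` the inverse isomorphism is `BD(ι_n)`, and both sides become the iterate at
`n + 1`. -/
theorem fixpoint_fold (A : Endofunctor.Algebra pointedBD.{u}) :
    pointedBD.map (stableFold A) ≫ A.str = stableFixpoint.hom ≫ stableFold A := by
  have hf (n : ℕ) : stableIncl n ≫ stableFold A = algebraIterate A n := stableIncl_desc _ _ _ n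
  have hs (n : ℕ) : stableIncl (n + 1) ≫ stableFixpoint.inv ≫
      pointedBD.map (stableFold A) ≫ A.str = stableIncl (n + 1) ≫ stableFold A := by
    refine (Category.assoc _ _ _).symm.trans ((congrArg (· ≫ pointedBD.map (stableFold A) ≫ A.str)
      (stableIncl_succ_unfold n)).trans ((Category.assoc _ _ _).symm.trans (Eq.trans ?_
        (hf (n + 1)).symm)))
    exact congrArg (· ≫ A.str) ((pointedBD.map_comp _ _).symm.trans
      (congrArg pointedBD.map (hf n)))
  refine (Iso.inv_comp_eq stableFixpoint).1 (stablePointed_hom_ext fun n => ?_)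
  -- `hs` only concerns successor stages. This suffices, since `ι_n` factors through `ι_(n+1)`, also
  -- for `n = 0`.
  rw [← pointedSuspension_stableIncl, Category.assoc, Category.assoc, hs]

/-- Uniqueness of the fold. At stage `0` the restriction of `f` is forced by the point. Writing
`ι_(n+1)` as `BD(ι_n)` followed by the isomorphism, the algebra square for `f` yields the recursion
that defines `algebraIterate`. -/
theorem stableIncl_algebraHom (A : Endofunctor.Algebra pointedBD.{u})
    (f : stablePointed.{u} ⟶ A.a)
    (hf : pointedBD.map f ≫ A.str = stableFixpoint.hom ≫ f) :
    ∀ n, stableIncl n ≫ f = algebraIterate A n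
  | 0 => Under.UnderMorphism.ext (Under.w f)
  | n + 1 => by
    refine (congrArg (· ≫ f) (BD_map_stableIncl_fixpoint n).symm).trans ((Category.assoc _ _ _).trans
      ((congrArg (pointedBD.map (stableIncl n) ≫ ·) hf.symm).trans
        ((Category.assoc _ _ _).symm.trans (congrArg (· ≫ A.str) ?_))))
    exact (pointedBD.map_comp _ _).symm.trans
      (congrArg pointedBD.map (stableIncl_algebraHom A f hf n))

/-- The fixpoint is an initial algebra. -/
noncomputable def stableAlgebraIsInitial :
    IsInitial (⟨stablePointed.{u}, stableFixpoint.hom⟩ : Endofunctor.Algebra pointedBD.{u}) :=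
  IsInitial.ofUniqueHom (fun A => ⟨stableFold A, fixpoint_fold A⟩) fun A m =>
    Endofunctor.Algebra.Hom.ext (stablePointed_hom_ext fun n =>
      (stableIncl_algebraHom A m.f m.h n).trans
        (stableIncl_desc A.a _ (pointedSuspension_algebraIterate A) n).symm)

end PolyMonad

/-- That the `S_n` and the `ι_n` preserve points is part of the construction of `pointedSuspension`
and `stableIncl`, from which the chain and the cocone are built. -/
theorem mainTheorem4 :
    ∃ φ : pointedBD.{u}.obj stablePointed.{u} ≅ stablePointed.{u},
      (∀ n : ℕ, pointedBD.{u}.map (stableIncl.{u} n) ≫ φ.hom = stableIncl.{u} (n + 1)) ∧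
      Nonempty (IsInitial (⟨stablePointed.{u}, φ.hom⟩ : Endofunctor.Algebra pointedBD.{u})) ∧
      Nonempty (IsColimit stableCocone.{u}) :=
  ⟨stableFixpoint, BD_map_stableIncl_fixpoint, ⟨stableAlgebraIsInitial⟩,
    ⟨stableCoconeIsColimit⟩⟩
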